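/- Graphs are finite, simple and undirected. A class of graphs is a set $X$ of graphs closed under isomorphism; it is hereditary if it is closed under taking induced subgraphs. For a graph $H$, a graph is $H$-free if it does not contain $H$ as an induced subgraph. Let $t, q$ be natural numbers and let $X$ be a hereditary class of graphs all of which are $K_t$-free and $K_{q,q}$-free. If $X$ is well-quasi-ordered by the induced subgraph relation (that is, $X$ contains neither an infinite sequence that is strictly decreasing with respect to this relation nor an infinite set of pairwise incomparable graphs), then $X$ has bounded treewidth: there is a constant $c$ such that every graph in $X$ has treewidth at most $c$. -/

import Mathlib

open scoped SimpleGraph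

universe u

/-- A finite simple graph (undirected, without loops and multiple edges), bundled with its
vertex set. -/
structure FinGraph : Type (u + 1) where
  /-- The vertex set. -/
  V : Type u
  /-- The vertex set is finite. -/
  finite : Finite V
  /-- The graph on this vertex set. -/
  graph : SimpleGraph V

namespace FinGraph

/-- `H.IsInducedSubgraph G`: the graph `H` is (isomorphic to) an induced subgraph of `G`,
that is, up to isomorphism it is obtained from `G` by vertex deletions. -/
def IsInducedSubgraph (H G : FinGraph.{u}) : Prop := H.graph ⊴ G.graph

/-- A class of graphs is hereditary if it is closed under taking induced subgraphs. As
`IsInducedSubgraph` is invariant under isomorphism, so is a hereditary class. -/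
def IsHereditary (X : Set FinGraph.{u}) : Prop :=
  ∀ G ∈ X, ∀ H : FinGraph.{u}, H.IsInducedSubgraph G → H ∈ X

/-- `X` is well-quasi-ordered by the induced subgraph relation. -/
def IsWQOByInducedSubgraph (X : Set FinGraph.{u}) : Prop :=
  WellQuasiOrdered fun H G : X => (H : FinGraph.{u}).IsInducedSubgraph (G : FinGraph.{u})

/-- `G.IsFree H`: the graph `G` is `H`-free, that is, `H` is not an induced subgraph of `G`. -/
def IsFree (G : FinGraph.{u}) {W : Type*} (H : SimpleGraph W) : Prop := ¬ H ⊴ G.graph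

end FinGraph

/-- A tree decomposition of a graph `G`. -/
structure TreeDecomposition {V : Type*} (G : SimpleGraph V) where
  /-- The (finite) set of nodes of the tree. -/
  Node : Type
  /-- There are finitely many nodes. -/
  finite : Finite Node
  /-- The tree. -/
  tree : SimpleGraph Node
  /-- It is a tree, hence connected, acyclic and nonempty. -/
  isTree : tree.IsTree
  /-- The bag of a node. -/
  bag : Node → Finset V
  /-- Every vertex lies in some bag. -/
  vertex_mem : ∀ v : V, ∃ i, v ∈ bag i
  /-- Every edge lies in some bag. -/
  edge_mem : ∀ v w : V, G.Adj v w → ∃ i, v ∈ bag i ∧ w ∈ bag i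
  /-- The nodes whose bags contain a given vertex induce a connected subgraph of the tree. -/
  connected : ∀ v : V, (tree.induce {i | v ∈ bag i}).Preconnected

/-- `D.WidthLE k`: the width of `D`, the maximum size of a bag minus one, is at most `k`. -/
def TreeDecomposition.WidthLE {V : Type*} {G : SimpleGraph V} (D : TreeDecomposition G)
    (k : ℕ) : Prop :=
  ∀ i, (D.bag i).card ≤ k + 1

/-- The treewidth of a graph on a finite vertex set: the least width of a tree decomposition
(the null graph gets the value `0`). The set is nonempty by
`exists_treeDecomposition_widthLE`. -/
noncomputable def treewidth {V : Type*} (G : SimpleGraph V) : ℕ :=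
  sInf {k | ∃ D : TreeDecomposition G, D.WidthLE k}

theorem exists_treeDecomposition_widthLE {V : Type*} [Finite V] (G : SimpleGraph V) :
    ∃ k, ∃ D : TreeDecomposition G, D.WidthLE k := by
  have := Fintype.ofFinite V
  refine ⟨Fintype.card V,
    { Node := Unit
      finite := inferInstance
      tree := ⊥
      isTree := SimpleGraph.IsTree.of_subsingleton
      bag := fun _ => Finset.univ
      vertex_mem := by simp
      edge_mem := by simp
      connected := fun v => SimpleGraph.Preconnected.of_subsingleton }, fun _ => ?_⟩
  exact Finset.card_le_univ _ |>.trans (Nat.le_succ _)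

theorem treewidth_le_iff {V : Type*} [Finite V] (G : SimpleGraph V) (k : ℕ) :
    treewidth G ≤ k ↔ ∃ D : TreeDecomposition G, D.WidthLE k := by
  constructor
  · intro h
    obtain ⟨D, hD⟩ := Nat.sInf_mem (exists_treeDecomposition_widthLE G)
    exact ⟨D, fun i => (hD i).trans (Nat.succ_le_succ h)⟩
  · exact fun h => Nat.sInf_le h

/-! Cycles of different lengths form an antichain, so well-quasi-ordering bounds the length of
induced cycles by some `l` (`exists_noHole`). By Ramsey's theorem, excluding a clique and an induced
balanced biclique excludes some biclique as a subgraph (`exists_bicliqueFree`). It remains to bound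
the treewidth of biclique-free graphs without long holes (`exists_treewidth_le`).

Treewidth is bounded once every set `U` of `4 * k` vertices has a balanced separator of size `k`
(`treewidth_le_of_balanced`). Connected sets containing more than half of `U` intersect pairwise,
and a set hitting all of them is such a separator; `exists_bounded_hitting_set` provides it. Let `D`
be the set of vertices that no `d` others separate from these connected sets. Vertices of `D` are
pairwise inseparable, so `D` is bounded (`exists_not_pairwise_inseparable`). Without long holes, a
component outside a ball attaches to the ball within a small region, so one ball of bounded radius
meets all members that avoid `D` (`NoHole.exists_ball_meeting`). Vertices outside `D` are cheaply
separated from the members, hence so is this ball (`exists_separator_of_ball`). Its separator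
together with `D` is the hitting set.

For the bound on `D`, inseparable nonadjacent vertices are first shown to have many short links
(`exists_robust_short_links`). Otherwise long links survive bounded deletions. Every link touches
each long window of a disjoint shortest one, so bounded connected sets can be split off repeatedly
(`LongLinkage.exists_succ`), until a window touched by all of them has a vertex with too many
neighbours in their union. Given short links, biclique-freeness lets one choose `l` branch vertices
and links that are clean and pairwise anticomplete (`exists_robust_cleanLinks`, `exists_free_tuple`,
`exists_pairwise_anticomplete`). Arranged cyclically, these produce a long hole
(`not_noHole_of_cyclic_links`). -/

namespace SimpleGraph

variable {V : Type*} {G : SimpleGraph V}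

/-! ### Connected sets, links and shortest links -/

/-- `S` is nonempty and induces a connected subgraph. -/
def ConnectedOn (G : SimpleGraph V) (S : Set V) : Prop := (G.induce S).Connected

/-- There is an edge between `S` and `T`. -/
def Touches (G : SimpleGraph V) (S T : Set V) : Prop := ∃ a ∈ S, ∃ b ∈ T, G.Adj a b

/-- All induced cycles have length at most `l`. -/
def NoHole (G : SimpleGraph V) (l : ℕ) : Prop := ∀ n, l < n → ¬ cycleGraph n ⊴ G

theorem Touches.symm {S T : Set V} (h : G.Touches S T) : G.Touches T S := by
  obtain ⟨a, ha, b, hb, hab⟩ := h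
  exact ⟨b, hb, a, ha, hab.symm⟩

theorem Touches.mono {S T S' T' : Set V} (h : G.Touches S T) (hS : S ⊆ S') (hT : T ⊆ T') :
    G.Touches S' T' := by
  obtain ⟨a, ha, b, hb, hab⟩ := h
  exact ⟨a, hS ha, b, hT hb, hab⟩

theorem ConnectedOn.nonempty {S : Set V} (h : G.ConnectedOn S) : S.Nonempty := by
  obtain ⟨x⟩ := Connected.nonempty h
  exact ⟨x.1, x.2⟩

theorem connectedOn_singleton (v : V) : G.ConnectedOn {v} := by
  have : Nonempty ({v} : Set V) := ⟨⟨v, rfl⟩⟩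
  exact { preconnected := Preconnected.of_subsingleton }

theorem ConnectedOn.union {S T : Set V} (hS : G.ConnectedOn S) (hT : G.ConnectedOn T)
    (h : (S ∩ T).Nonempty) : G.ConnectedOn (S ∪ T) :=
  induce_union_connected hS.preconnected hT.preconnected h

theorem ConnectedOn.union_of_touches {S T : Set V} (hS : G.ConnectedOn S) (hT : G.ConnectedOn T)
    (h : G.Touches S T) : G.ConnectedOn (S ∪ T) := by
  obtain ⟨a, ha, b, hb, hab⟩ := h
  exact connected_induce_union hS.preconnected hT.preconnected ha hb hab

theorem ConnectedOn.insert_of_adj {S : Set V} (hS : G.ConnectedOn S) {a b : V} (ha : a ∈ S)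
    (hab : G.Adj a b) : G.ConnectedOn (insert b S) := by
  rw [← Set.union_singleton]
  exact hS.union_of_touches (connectedOn_singleton b) ⟨a, ha, b, rfl, hab⟩

/-- `f 0, …, f n` is a walk inside `P` from a neighbour of `A` to a neighbour of `B`. -/
structure LinkPath (G : SimpleGraph V) (A B P : Set V) (n : ℕ) (f : ℕ → V) : Prop where
  mem : ∀ i ≤ n, f i ∈ P
  adj : ∀ i < n, G.Adj (f i) (f (i + 1))
  left : ∃ a ∈ A, G.Adj a (f 0)
  right : ∃ b ∈ B, G.Adj (f n) b

/-- A shortest walk inside `P` from a neighbour of `A` to a neighbour of `B`. -/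
structure MinLinkPath (G : SimpleGraph V) (A B P : Set V) (n : ℕ) (f : ℕ → V) : Prop
    extends LinkPath G A B P n f where
  min : ∀ m g, LinkPath G A B P m g → n ≤ m

/-- `P` is a connected set that touches both `A` and `B`. -/
structure IsLink (G : SimpleGraph V) (A B P : Set V) : Prop where
  conn : G.ConnectedOn P
  left : G.Touches A P
  right : G.Touches P B

theorem ConnectedOn.exists_path {P : Set V} (hP : G.ConnectedOn P) {a b : V} (ha : a ∈ P)
    (hb : b ∈ P) : ∃ (n : ℕ) (f : ℕ → V), f 0 = a ∧ f n = b ∧ (∀ i ≤ n, f i ∈ P) ∧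
      ∀ i < n, G.Adj (f i) (f (i + 1)) := by
  obtain ⟨w⟩ := hP.preconnected ⟨a, ha⟩ ⟨b, hb⟩
  refine ⟨w.length, fun i => (w.getVert i).1, by simp, by simp, fun i _ => (w.getVert i).2, ?_⟩
  intro i hi
  exact w.adj_getVert_succ hi

theorem connectedOn_image {f : ℕ → V} {i j : ℕ} (hij : i ≤ j)
    (h : ∀ k, i ≤ k → k < j → G.Adj (f k) (f (k + 1))) : G.ConnectedOn (f '' Set.Icc i j) := by
  induction j, hij using Nat.le_induction with
  | base => simpa using connectedOn_singleton (f i)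
  | succ j hij ih =>
    have h1 := (ih fun k hk hkj => h k hk (by omega)).insert_of_adj
      (Set.mem_image_of_mem f ⟨hij, le_rfl⟩) (h j hij (by omega))
    convert h1 using 1
    ext x
    simp only [Set.mem_image, Set.mem_Icc, Set.mem_insert_iff]
    constructor
    · rintro ⟨k, ⟨h1, h2⟩, rfl⟩
      rcases Nat.lt_or_ge k (j + 1) with h3 | h3
      · exact Or.inr ⟨k, ⟨h1, by omega⟩, rfl⟩
      · exact Or.inl (by rw [show k = j + 1 by omega])
    · rintro (rfl | ⟨k, ⟨h1, h2⟩, rfl⟩)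
      · exact ⟨j + 1, ⟨by omega, le_rfl⟩, rfl⟩
      · exact ⟨k, ⟨h1, by omega⟩, rfl⟩

theorem IsLink.exists_linkPath {A B P : Set V} (h : G.IsLink A B P) :
    ∃ n f, G.LinkPath A B P n f := by
  obtain ⟨a, ha, b, hb, hab⟩ := h.left
  obtain ⟨c, hc, d, hd, hcd⟩ := h.right
  obtain ⟨n, f, h0, hn, hm, hadj⟩ := h.conn.exists_path hb hc
  exact ⟨n, f, hm, hadj, ⟨a, ha, h0 ▸ hab⟩, ⟨d, hd, hn ▸ hcd⟩⟩

theorem LinkPath.exists_min {A B P : Set V} {n : ℕ} {f : ℕ → V} (h : G.LinkPath A B P n f) :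
    ∃ n f, G.MinLinkPath A B P n f := by
  classical
  have hex : ∃ n f, G.LinkPath A B P n f := ⟨n, f, h⟩
  obtain ⟨g, hg⟩ := Nat.find_spec hex
  exact ⟨Nat.find hex, g, hg, fun m g' hg' => Nat.find_min' hex ⟨g', hg'⟩⟩

theorem IsLink.exists_min {A B P : Set V} (h : G.IsLink A B P) :
    ∃ n f, G.MinLinkPath A B P n f := by
  obtain ⟨n, f, hf⟩ := h.exists_linkPath
  exact hf.exists_min

theorem LinkPath.isLink {A B P : Set V} {n : ℕ} {f : ℕ → V} (h : G.LinkPath A B P n f) :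
    G.IsLink A B (f '' Set.Icc 0 n) := by
  refine ⟨connectedOn_image (Nat.zero_le n) fun k _ hk => h.adj k hk, ?_, ?_⟩
  · obtain ⟨a, ha, hab⟩ := h.left
    exact ⟨a, ha, f 0, ⟨0, by simp, rfl⟩, hab⟩
  · obtain ⟨a, ha, hab⟩ := h.right
    exact ⟨f n, ⟨n, by simp, rfl⟩, a, ha, hab⟩

theorem LinkPath.image_subset {A B P : Set V} {n : ℕ} {f : ℕ → V} (h : G.LinkPath A B P n f) :
    f '' Set.Icc 0 n ⊆ P := by
  rintro _ ⟨i, hi, rfl⟩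
  exact h.mem i hi.2

namespace MinLinkPath

variable {A B P : Set V} {n : ℕ} {f : ℕ → V}

/-- A late neighbour of `A`, an early neighbour of `B`, a chord or a repeated vertex would each
shorten the walk. Hence a shortest walk is an induced path, and only its ends see `A` and `B`. -/
theorem eq_zero (h : G.MinLinkPath A B P n f) {i : ℕ} (hi : i ≤ n) {a : V} (ha : a ∈ A)
    (hadj : G.Adj a (f i)) : i = 0 := by
  have := h.min (n - i) (fun k => f (k + i))
    ⟨fun k hk => h.mem _ (by omega), fun k hk => by
      have := h.adj (k + i) (by omega)
      rwa [show k + i + 1 = k + 1 + i by omega] at this, ⟨a, ha, by simpa using hadj⟩, by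
      simpa [Nat.sub_add_cancel hi] using h.right⟩
  omega

theorem eq_last (h : G.MinLinkPath A B P n f) {i : ℕ} (hi : i ≤ n) {b : V} (hb : b ∈ B)
    (hadj : G.Adj (f i) b) : i = n := by
  have := h.min i f
    ⟨fun k hk => h.mem _ (by omega), fun k hk => h.adj _ (by omega), h.left, ⟨b, hb, hadj⟩⟩
  omega

theorem adj_imp (h : G.MinLinkPath A B P n f) {i j : ℕ} (hij : i < j) (hj : j ≤ n)
    (hadj : G.Adj (f i) (f j)) : j = i + 1 := by
  have := h.min (n - (j - i - 1)) (fun k => if k ≤ i then f k else f (k + (j - i - 1)))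
    ⟨fun k hk => by split_ifs <;> exact h.mem _ (by omega), fun k hk => by
      split_ifs with h1 h2 h2
      · exact h.adj k (by omega)
      · rwa [show k = i by omega, show i + 1 + (j - i - 1) = j by omega]
      · omega
      · have := h.adj (k + (j - i - 1)) (by omega)
        rwa [show k + (j - i - 1) + 1 = k + 1 + (j - i - 1) by omega] at this,
      by simpa using h.left, by
      rw [if_neg (by omega), show n - (j - i - 1) + (j - i - 1) = n by omega]
      exact h.right⟩
  omega

theorem ne_of_lt (h : G.MinLinkPath A B P n f) {i j : ℕ} (hij : i < j) (hj : j ≤ n) :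
    f i ≠ f j := by
  intro heq
  have := h.min (n - (j - i)) (fun k => if k ≤ i then f k else f (k + (j - i)))
    ⟨fun k hk => by split_ifs <;> exact h.mem _ (by omega), fun k hk => by
      split_ifs with h1 h2 h2
      · exact h.adj k (by omega)
      · rw [show k = i by omega, heq, show i + 1 + (j - i) = j + 1 by omega]
        exact h.adj j (by omega)
      · omega
      · have := h.adj (k + (j - i)) (by omega)
        rwa [show k + (j - i) + 1 = k + 1 + (j - i) by omega] at this,
      by simpa using h.left, by
      split_ifs with h1
      · rw [show n - (j - i) = i by omega, heq, show j = n by omega]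
        exact h.right
      · rw [show n - (j - i) + (j - i) = n by omega]
        exact h.right⟩
  omega

theorem inj (h : G.MinLinkPath A B P n f) {i j : ℕ} (hi : i ≤ n) (hj : j ≤ n)
    (heq : f i = f j) : i = j := by
  rcases lt_trichotomy i j with h1 | h1 | h1
  · exact absurd heq (h.ne_of_lt h1 hj)
  · exact h1
  · exact absurd heq.symm (h.ne_of_lt h1 hi)

theorem adj_iff (h : G.MinLinkPath A B P n f) {i j : ℕ} (hi : i ≤ n) (hj : j ≤ n) :
    G.Adj (f i) (f j) ↔ i + 1 = j ∨ j + 1 = i := by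
  constructor
  · intro hadj
    rcases lt_trichotomy i j with h1 | h1 | h1
    · exact Or.inl (h.adj_imp h1 hj hadj).symm
    · exact absurd hadj (by simp [h1])
    · exact Or.inr (h.adj_imp h1 hi hadj.symm).symm
  · rintro (rfl | rfl)
    · exact h.adj i (by omega)
    · exact (h.adj j (by omega)).symm

end MinLinkPath

/-! ### Long induced cycles from paths and links -/

theorem cycleGraph_adj_iff_of_lt {n : ℕ} {u v : Fin n} (huv : u < v) :
    (cycleGraph n).Adj u v ↔ v.1 = u.1 + 1 ∨ u.1 + n = v.1 + 1 := by
  rw [cycleGraph_adj', Fin.coe_sub_iff_lt.2 huv, Fin.coe_sub_iff_le.2 huv.le]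
  have := u.2
  have := v.2
  have : u.1 < v.1 := huv
  omega

theorem cycleGraph_isIndContained {n : ℕ} (g : ℕ → V)
    (hinj : ∀ i j, i < j → j < n → g i ≠ g j)
    (hadj : ∀ i j, i < j → j < n → (G.Adj (g i) (g j) ↔ j = i + 1 ∨ i + n = j + 1)) :
    cycleGraph n ⊴ G := by
  refine ⟨⟨⟨fun i => g i.1, ?_⟩, ?_⟩⟩
  · intro i j hij
    rcases lt_trichotomy i j with h | h | h
    · exact absurd hij (hinj _ _ h j.2)
    · exact h
    · exact absurd hij.symm (hinj _ _ h i.2)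
  · intro i j
    change G.Adj (g i.1) (g j.1) ↔ _
    rcases lt_trichotomy i j with h | h | h
    · rw [hadj _ _ h j.2, cycleGraph_adj_iff_of_lt h]
    · simp [h]
    · rw [G.adj_comm, hadj _ _ h i.2, SimpleGraph.adj_comm, cycleGraph_adj_iff_of_lt h]

/-- An induced path whose ends, but no inner vertices, have neighbours in a disjoint connected
set lies on an induced cycle. -/
theorem not_noHole_of_path {l k : ℕ} (hk : 3 ≤ k) (hlk : l ≤ k) {w : ℕ → V} {Q : Set V}
    (hinj : ∀ i j, i < k → j < k → w i = w j → i = j)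
    (hadj : ∀ i j, i < k → j < k → (G.Adj (w i) (w j) ↔ i + 1 = j ∨ j + 1 = i))
    (hQ : G.ConnectedOn Q) (hwQ : ∀ i < k, w i ∉ Q) (h0 : ∃ a ∈ Q, G.Adj (w 0) a)
    (h1 : ∃ a ∈ Q, G.Adj (w (k - 1)) a)
    (hmid : ∀ i, 0 < i → i + 1 < k → ∀ q ∈ Q, ¬ G.Adj (w i) q) : ¬ G.NoHole l := by
  intro hno
  have hlink : G.IsLink {w (k - 1)} {w 0} Q := by
    refine ⟨hQ, ?_, ?_⟩
    · obtain ⟨a, ha, haw⟩ := h1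
      exact ⟨_, rfl, a, ha, haw⟩
    · obtain ⟨a, ha, haw⟩ := h0
      exact ⟨a, ha, _, rfl, haw.symm⟩
  obtain ⟨n, f, hf⟩ := hlink.exists_min
  -- The cycle is `w` followed by a shortest return path `f` through `Q`, which contributes `n + 1`
  -- vertices.
  refine hno (k + n + 1) (by omega)
    (cycleGraph_isIndContained (fun i => if i < k then w i else f (i - k)) ?_ ?_)
  · intro i j hij hj
    split_ifs with h1 h2 h2
    · intro h
      exact absurd (hinj _ _ h1 h2 h) (by omega)
    · intro h
      exact hwQ i h1 (h ▸ hf.mem (j - k) (by omega))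
    · omega
    · exact hf.ne_of_lt (by omega) (by omega)
  · intro i j hij hj
    split_ifs with h1 h2 h2
    · rw [hadj _ _ h1 h2]
      omega
    · have hmem := hf.mem (j - k) (by omega)
      rcases Nat.eq_zero_or_pos i with rfl | hi
      · have key : G.Adj (w 0) (f (j - k)) ↔ j - k = n := by
          constructor
          · intro h
            exact hf.eq_last (by omega) rfl h.symm
          · intro h
            obtain ⟨b, hb, hab⟩ := hf.right
            rw [Set.mem_singleton_iff] at hb
            rw [h, ← hb]
            exact hab.symm
        rw [key]
        omega
      · by_cases hik : i + 1 < k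
        · have := hmid i hi hik _ hmem
          simp only [this, false_iff]
          omega
        · have hi' : i = k - 1 := by omega
          have key : G.Adj (w i) (f (j - k)) ↔ j - k = 0 := by
            constructor
            · intro h
              exact hf.eq_zero (by omega) (a := w i) (by simp [hi']) h
            · intro h
              obtain ⟨b, hb, hab⟩ := hf.left
              rw [Set.mem_singleton_iff] at hb
              rw [h, hi', ← hb]
              exact hab
          rw [key]
          omega
    · omega
    · rw [hf.adj_iff (by omega) (by omega)]
      omega

/-- A window of a shortest path between `A` and `B` is touched by every disjoint connected set
that joins `A` and `B`. -/
theorem MinLinkPath.touches_window {l n i k : ℕ} {A B P T : Set V} {f : ℕ → V}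
    (hf : G.MinLinkPath A B P n f) (hno : G.NoHole l) (hk : 3 ≤ k) (hlk : l ≤ k)
    (hi : i + k ≤ n + 1) (hA : Disjoint A P) (hB : Disjoint B P)
    (hT : G.ConnectedOn (T ∪ A ∪ B)) (hTw : ∀ j, i ≤ j → j < i + k → f j ∉ T) :
    ∃ j, i ≤ j ∧ j < i + k ∧ ∃ t ∈ T, G.Adj t (f j) := by
  by_contra hcon
  push Not at hcon
  -- If `T` misses the window, then `T ∪ A ∪ B` with the rest of the path is a connected set in
  -- which only the ends of the window have neighbours. `Q1` adds the part before the window, `Q`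
  -- the part after it.
  obtain ⟨Q1, hQ1, hQ1sub, hQ1l⟩ : ∃ Q, G.ConnectedOn Q ∧ T ∪ A ∪ B ⊆ Q ∧
      (∀ x ∈ Q, x ∈ T ∪ A ∪ B ∨ ∃ j < i, x = f j) ∧ ∃ a ∈ Q, G.Adj (f i) a := by
    obtain ⟨a, ha, ha0⟩ := hf.left
    rcases Nat.eq_zero_or_pos i with rfl | hpos
    · exact ⟨_, hT, le_rfl, fun x hx => Or.inl hx, a, by simp [ha], ha0.symm⟩
    · refine ⟨T ∪ A ∪ B ∪ f '' Set.Icc 0 (i - 1), hT.union_of_touches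
        (connectedOn_image (by omega) fun k _ hk => hf.adj k (by omega))
        ⟨a, by simp [ha], f 0, ⟨0, by simp, rfl⟩, ha0⟩, Set.subset_union_left, ?_,
        f (i - 1), Or.inr ⟨i - 1, by simp, rfl⟩, ?_⟩
      · rintro x (hx | ⟨j, hj, rfl⟩)
        · exact Or.inl hx
        · exact Or.inr ⟨j, by have := hj.2; omega, rfl⟩
      · have := hf.adj (i - 1) (by omega)
        rw [show i - 1 + 1 = i by omega] at this
        exact this.symm
  obtain ⟨Q, hQ, hQsub, hQl, hQr⟩ : ∃ Q, G.ConnectedOn Q ∧ Q1 ⊆ Q ∧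
      (∀ x ∈ Q, x ∈ Q1 ∨ ∃ j, i + k ≤ j ∧ j ≤ n ∧ x = f j) ∧
      ∃ a ∈ Q, G.Adj (f (i + (k - 1))) a := by
    obtain ⟨b, hb, hbn⟩ := hf.right
    have hbQ : b ∈ Q1 := hQ1sub (by simp [hb])
    rcases Nat.lt_or_ge n (i + k) with hlt | hge
    · refine ⟨_, hQ1, le_rfl, fun x hx => Or.inl hx, b, hbQ, ?_⟩
      rwa [show i + (k - 1) = n by omega]
    · refine ⟨Q1 ∪ f '' Set.Icc (i + k) n, hQ1.union_of_touches
        (connectedOn_image hge fun k _ hk => hf.adj k (by omega))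
        ⟨b, hbQ, f n, ⟨n, by simp [hge], rfl⟩, hbn.symm⟩, Set.subset_union_left, ?_,
        f (i + k), Or.inr ⟨i + k, by simp [hge], rfl⟩, ?_⟩
      · rintro x (hx | ⟨j, hj, rfl⟩)
        · exact Or.inl hx
        · exact Or.inr ⟨j, hj.1, hj.2, rfl⟩
      · have := hf.adj (i + (k - 1)) (by omega)
        rwa [show i + (k - 1) + 1 = i + k by omega] at this
  have hcases : ∀ x ∈ Q, x ∈ T ∨ x ∈ A ∨ x ∈ B ∨ ∃ j, (j < i ∨ i + k ≤ j) ∧ j ≤ n ∧ x = f j := by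
    intro x hx
    rcases hQl x hx with h | ⟨j, h1, h2, h3⟩
    · rcases hQ1l.1 x h with ((h | h) | h) | ⟨j, hj, h⟩
      · exact Or.inl h
      · exact Or.inr (Or.inl h)
      · exact Or.inr (Or.inr (Or.inl h))
      · exact Or.inr (Or.inr (Or.inr ⟨j, Or.inl hj, by omega, h⟩))
    · exact Or.inr (Or.inr (Or.inr ⟨j, Or.inr h1, h2, h3⟩))
  refine not_noHole_of_path hk hlk (w := fun j => f (i + j)) (Q := Q) ?_ ?_ hQ ?_ ?_ hQr ?_ hno
  · intro a b ha hb hab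
    have := hf.inj (by omega) (by omega) hab
    omega
  · intro a b ha hb
    rw [hf.adj_iff (by omega) (by omega)]
    omega
  · intro j hj hx
    have hmem := hf.mem (i + j) (by omega)
    rcases hcases _ hx with h | h | h | ⟨j', h1, h2, h3⟩
    · exact hTw _ (by omega) (by omega) h
    · exact Set.disjoint_left.1 hA h hmem
    · exact Set.disjoint_left.1 hB h hmem
    · have := hf.inj (by omega) h2 h3
      omega
  · obtain ⟨a, ha, hadj⟩ := hQ1l.2
    exact ⟨a, hQsub ha, by simpa using hadj⟩
  · intro j h0 hjk q hq hadj
    rcases hcases _ hq with h | h | h | ⟨j', h1, h2, rfl⟩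
    · exact hcon _ (by omega) (by omega) q h hadj.symm
    · have := hf.eq_zero (by omega) h hadj.symm
      omega
    · have := hf.eq_last (by omega) h hadj
      omega
    · rw [hf.adj_iff (by omega) h2] at hadj
      omega

/-- Two disjoint and anticomplete links between connected sets, one of them long, yield a long
induced cycle. -/
theorem not_noHole_of_two_links {l : ℕ} (hl : 3 ≤ l) {A B P₁ P₂ : Set V}
    (hA : G.ConnectedOn A) (hB : G.ConnectedOn B) (h1 : G.IsLink A B P₁) (h2 : G.IsLink A B P₂)
    (hAP : Disjoint A P₁) (hBP : Disjoint B P₁) (hd : Disjoint P₁ P₂) (ht : ¬ G.Touches P₂ P₁)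
    (hlong : ∀ n f, G.LinkPath A B P₁ n f → l ≤ n + 1) : ¬ G.NoHole l := by
  intro hno
  obtain ⟨n, f, hf⟩ := h1.exists_min
  have hn := hlong n f hf.toLinkPath
  -- The window is the whole shortest path in `P₁`.
  obtain ⟨j, -, hj, t, ht', hadj⟩ := hf.touches_window hno (i := 0) (k := n + 1) (T := P₂)
    (by omega) hn (by omega) hAP hBP
    ((h2.conn.union_of_touches hA h2.left.symm).union_of_touches hB
      (h2.right.mono Set.subset_union_left le_rfl))
    (fun j _ hj h => Set.disjoint_left.1 hd (hf.mem j (by omega)) h)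
  exact ht ⟨t, ht', f j, hf.mem j (by omega), hadj⟩

/-! ### Heavy vertices and anticomplete families -/

/-- `G` has no complete bipartite subgraph with `s` vertices on each side. -/
def BicliqueFree (G : SimpleGraph V) (s : ℕ) : Prop :=
  ∀ S T : Finset V, S.card = s → T.card = s → ¬ ∀ a ∈ S, ∀ b ∈ T, G.Adj a b

/-- Every set of at most `b` vertices is avoided by a member of `F`. -/
def Robust (F : Set (Finset V)) (b : ℕ) : Prop :=
  ∀ Z : Finset V, Z.card ≤ b → ∃ P ∈ F, Disjoint Z P

open Classical in
/-- In a biclique-free graph few vertices have many neighbours in a bounded set. -/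
theorem BicliqueFree.exists_few_heavy [Finite V] {s : ℕ} (h : G.BicliqueFree s) (Y : Finset V) :
    ∃ Z : Finset V, Z.card ≤ s * 2 ^ Y.card ∧ ∀ v ∉ Z, (Y.filter (G.Adj v)).card < s := by
  have := Fintype.ofFinite V
  refine ⟨Finset.univ.filter fun v => s ≤ (Y.filter (G.Adj v)).card, ?_, fun v hv => by
    simpa using hv⟩
  by_contra! hcon
  -- Pigeonhole on traces in `Y`: more than `s` vertices share a trace of size at least `s`, which
  -- is a biclique.
  rw [← Finset.card_powerset, mul_comm] at hcon
  obtain ⟨T, -, hT⟩ := Finset.exists_lt_card_fiber_of_mul_lt_card_of_maps_to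
    (f := fun v => Y.filter (G.Adj v)) (fun v _ => by simp [Finset.filter_subset]) hcon
  obtain ⟨S, hS, hSc⟩ := Finset.exists_subset_card_eq hT.le
  obtain ⟨v, hv⟩ := Finset.card_pos.1 (lt_of_le_of_lt (Nat.zero_le _) hT)
  simp only [Finset.mem_filter, Finset.mem_univ, true_and] at hv
  obtain ⟨T', hT', hTc'⟩ := Finset.exists_subset_card_eq (hv.2 ▸ hv.1)
  refine h S T' hSc hTc' fun a ha b hb => ?_
  have h1 := hS ha
  simp only [Finset.mem_filter, Finset.mem_univ, true_and] at h1
  have h2 := hT' hb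
  rw [← h1.2, Finset.mem_filter] at h2
  exact h2.2

open Classical in
/-- A small set touching many disjoint sets has a vertex with many neighbours in their union. -/
theorem exists_heavy_of_touches {s c m : ℕ} (hm : c * s < m) {T : ℕ → Finset V} {P Y : Finset V}
    (hP : P.card ≤ c) (hT : ∀ i j, i < j → j < m → Disjoint (T i) (T j))
    (hY : ∀ i < m, T i ⊆ Y) (ht : ∀ i < m, G.Touches (T i) P) :
    ∃ v ∈ P, s ≤ (Y.filter (G.Adj v)).card := by
  have ht' : ∀ i, ∃ v t, i < m → v ∈ P ∧ t ∈ T i ∧ G.Adj v t := by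
    intro i
    by_cases hi : i < m
    · obtain ⟨t, hti, v, hv, hadj⟩ := ht i hi
      exact ⟨v, t, fun _ => ⟨hv, hti, hadj.symm⟩⟩
    · obtain ⟨t, -, v, -, -⟩ := ht 0 (by omega)
      exact ⟨v, v, fun h => absurd h hi⟩
  choose v t hvt using ht'
  have hcard : P.card * s < (Finset.range m).card := by
    rw [Finset.card_range]
    exact lt_of_le_of_lt (Nat.mul_le_mul_right _ hP) hm
  obtain ⟨x, hxP, hx⟩ := Finset.exists_lt_card_fiber_of_mul_lt_card_of_maps_to
    (f := v) (fun i hi => (hvt i (by simpa using hi)).1) hcard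
  refine ⟨x, hxP, hx.le.trans ?_⟩
  refine Finset.card_le_card_of_injOn t ?_ ?_
  · intro i hi
    simp only [Finset.coe_filter, Finset.mem_range, Set.mem_ofPred_eq] at hi
    obtain ⟨h1, h2, h3⟩ := hvt i hi.1
    simp only [Finset.coe_filter, Set.mem_ofPred_eq]
    exact ⟨hY i hi.1 h2, hi.2 ▸ h3⟩
  · intro i hi j hj hij
    simp only [Finset.coe_filter, Finset.mem_range, Set.mem_ofPred_eq] at hi hj
    have h1 := (hvt i hi.1).2.1
    have h2 := (hvt j hj.1).2.1
    rcases lt_trichotomy i j with h | h | h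
    · exact absurd (hij ▸ h2) (Finset.disjoint_left.1 (hT i j h hj.1) h1)
    · exact h
    · exact absurd h1 (Finset.disjoint_left.1 (hT j i h hi.1) (hij ▸ h2))

/-- Otherwise every member has a bounded blocker, and all members avoiding the blocker touch it.
Choose `c * s + 1` disjoint members greedily, each avoiding the earlier blockers. A further member
that avoids all blockers and the heavy vertices touches every chosen one, so one of its at most `c`
vertices is heavy after all. -/
theorem exists_robust_anticomplete (s c b : ℕ) : ∃ b' : ℕ, ∀ {V : Type u} [Finite V]
    {G : SimpleGraph V}, G.BicliqueFree s → ∀ F : Set (Finset V), (∀ P ∈ F, P.card ≤ c) →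
    Robust F b' →
    ∃ P ∈ F, Robust {P' ∈ F | Disjoint P P' ∧ ¬ G.Touches (P : Set V) P'} b := by
  classical
  -- The first summand pays for the blockers, each enlarged by its member, the second for the heavy
  -- vertices.
  refine ⟨(c * s + 1) * (b + c) + s * 2 ^ ((c * s + 1) * c), ?_⟩
  intro V _ G hG F hF hrob
  by_contra! hcon
  have hcon' : ∀ P ∈ F, ∃ Z : Finset V, Z.card ≤ b + c ∧ P ⊆ Z ∧
      ∀ P' ∈ F, Disjoint Z P' → G.Touches (P : Set V) P' := by
    intro P hP
    have := hcon P hP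
    unfold Robust at this
    push Not at this
    obtain ⟨Z, hZ, hZP⟩ := this
    refine ⟨Z ∪ P, (Finset.card_union_le _ _).trans (add_le_add hZ (hF P hP)),
      Finset.subset_union_right, fun P' hP' hd => ?_⟩
    rw [Finset.disjoint_union_left] at hd
    by_contra ht
    exact hZP P' ⟨hP', hd.2, ht⟩ hd.1
  have key : ∀ m ≤ c * s + 1, ∃ (T : ℕ → Finset V) (W : Finset V),
      (∀ j < m, T j ∈ F) ∧ (∀ i j, i < j → j < m → Disjoint (T i) (T j)) ∧
      W.card ≤ m * (b + c) ∧ (∀ j < m, T j ⊆ W) ∧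
      ∀ j < m, ∀ P' ∈ F, Disjoint W P' → G.Touches (T j : Set V) P' := by
    intro m
    induction m with
    | zero => exact fun _ => ⟨fun _ => ∅, ∅, by simp⟩
    | succ m ih =>
      intro hm
      obtain ⟨T, W, h1, h2, h3, h4, h5⟩ := ih (by omega)
      have hmle : m * (b + c) ≤ (c * s + 1) * (b + c) := Nat.mul_le_mul_right _ (by omega)
      obtain ⟨P, hP, hWP⟩ := hrob W (by omega)
      obtain ⟨Z, hZ, hPZ, hZt⟩ := hcon' P hP
      refine ⟨fun j => if j < m then T j else P, W ∪ Z, ?_, ?_, ?_, ?_, ?_⟩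
      · intro j hj
        dsimp only
        split_ifs with h
        exacts [h1 j h, hP]
      · intro i j hij hj
        dsimp only
        rw [if_pos (by omega)]
        split_ifs with h
        · exact h2 i j hij h
        · exact hWP.mono_left (h4 i (by omega))
      · calc (W ∪ Z).card ≤ W.card + Z.card := Finset.card_union_le _ _
          _ ≤ m * (b + c) + (b + c) := add_le_add h3 hZ
          _ = (m + 1) * (b + c) := by ring
      · intro j hj
        dsimp only
        split_ifs with h
        · exact (h4 j h).trans Finset.subset_union_left
        · exact hPZ.trans Finset.subset_union_right
      · intro j hj P' hP' hd
        rw [Finset.disjoint_union_left] at hd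
        dsimp only
        split_ifs with h
        · exact h5 j h P' hP' hd.1
        · exact hZt P' hP' hd.2
  obtain ⟨T, W, h1, h2, h3, h4, h5⟩ := key _ le_rfl
  set Y := (Finset.range (c * s + 1)).biUnion T with hYdef
  have hY : Y.card ≤ (c * s + 1) * c := by
    have := Finset.card_biUnion_le_card_mul (Finset.range (c * s + 1)) T c
      (fun i hi => hF _ (h1 i (by simpa using hi)))
    simpa using this
  obtain ⟨Z, hZ, hZlight⟩ := hG.exists_few_heavy Y
  have hZ' : Z.card ≤ s * 2 ^ ((c * s + 1) * c) :=
    hZ.trans (Nat.mul_le_mul_left _ (Nat.pow_le_pow_right (by norm_num) hY))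
  obtain ⟨P, hP, hd⟩ := hrob (W ∪ Z) ((Finset.card_union_le _ _).trans (add_le_add h3 hZ'))
  rw [Finset.disjoint_union_left] at hd
  obtain ⟨v, hv, hvs⟩ := exists_heavy_of_touches (G := G) (s := s) (Y := Y)
    (Nat.lt_succ_self (c * s))
    (hF P hP) h2 (fun i hi => Finset.subset_biUnion_of_mem T (by simpa using hi))
    (fun i hi => h5 i hi P hP hd.1)
  exact absurd hvs (not_le.2 (hZlight v fun h => Finset.disjoint_left.1 hd.2 h hv))

/-- A sufficiently robust family of bounded sets in a biclique-free graph contains many pairwise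
disjoint and anticomplete members. -/
theorem exists_pairwise_anticomplete (s c n : ℕ) : ∃ b : ℕ, ∀ {V : Type u} [Finite V]
    {G : SimpleGraph V}, G.BicliqueFree s → ∀ F : Set (Finset V), (∀ P ∈ F, P.card ≤ c) →
    Robust F b → ∃ T : ℕ → Finset V, (∀ i < n, T i ∈ F) ∧
      ∀ i j, i < j → j < n → Disjoint (T i) (T j) ∧ ¬ G.Touches (T i : Set V) (T j) := by
  induction n with
  | zero => exact ⟨0, fun _ _ _ _ => ⟨fun _ => ∅, by simp⟩⟩
  | succ n ih =>
    obtain ⟨b, hb⟩ := ih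
    obtain ⟨b', hb'⟩ := exists_robust_anticomplete.{u} s c b
    refine ⟨b', fun {V} _ {G} hG F hF hrob => ?_⟩
    obtain ⟨P, hP, hPr⟩ := hb' hG F hF hrob
    obtain ⟨T, hT1, hT2⟩ := hb hG _ (fun P hP => hF P hP.1) hPr
    refine ⟨fun i => match i with | 0 => P | i + 1 => T i, ?_, ?_⟩
    · rintro (_ | i) hi
      · exact hP
      · exact (hT1 i (by omega)).1
    · rintro (_ | i) (_ | j) hij hj
      · omega
      · exact (hT1 j (by omega)).2
      · omega
      · exact hT2 i j (by omega) (by omega)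

/-! ### Long linkages -/

/-- Two connected sets joined robustly by long links inside `U`, together with `i` disjoint
connected sets of bounded size outside `U`, each joined to both of them. -/
structure LongLinkage (G : SimpleGraph V) (l : ℕ) (A B U : Set V) (σ : ℕ → Finset V) (i d : ℕ) :
    Prop where
  left : G.ConnectedOn A
  right : G.ConnectedOn B
  disj_left : Disjoint A U
  disj_right : Disjoint B U
  long : ∀ n f, G.LinkPath A B U n f → l ≤ n + 1
  robust : ∀ Z : Finset V, Z.card ≤ d → ∃ P ⊆ U, G.IsLink A B P ∧ Disjoint (Z : Set V) P
  card_le : ∀ j < i, (σ j).card ≤ 3 * l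
  disj : ∀ j < i, Disjoint (σ j : Set V) U
  pairwise : ∀ j k, j < k → k < i → Disjoint (σ j) (σ k)
  conn : ∀ j < i, G.ConnectedOn (σ j)
  conn_left : ∀ j < i, G.ConnectedOn (σ j ∪ A)
  conn_right : ∀ j < i, G.ConnectedOn (σ j ∪ B)

theorem LinkPath.mono {A B P P' : Set V} {n : ℕ} {f : ℕ → V} (h : G.LinkPath A B P n f)
    (hP : P ⊆ P') : G.LinkPath A B P' n f :=
  ⟨fun i hi => hP (h.mem i hi), h.adj, h.left, h.right⟩

namespace LongLinkage

variable {A B U : Set V} {σ : ℕ → Finset V} {i d l : ℕ}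

/-- The parameter `d` is a budget of vertices that may still be deleted from `U`. -/
theorem sdiff (h : G.LongLinkage l A B U σ i d) (Z : Finset V) {d' : ℕ} (hd : Z.card + d' ≤ d) :
    G.LongLinkage l A B (U \ Z) σ i d' where
  left := h.left
  right := h.right
  disj_left := h.disj_left.mono_right Set.sdiff_subset
  disj_right := h.disj_right.mono_right Set.sdiff_subset
  long n f hf := h.long n f (hf.mono Set.sdiff_subset)
  robust Z' hZ' := by
    classical
    obtain ⟨P, hP, hl, hZ⟩ := h.robust (Z ∪ Z') ((Finset.card_union_le _ _).trans (by omega))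
    rw [Finset.coe_union, Set.disjoint_union_left] at hZ
    exact ⟨P, fun x hx => ⟨hP hx, fun hxZ => Set.disjoint_left.1 hZ.1 hxZ hx⟩, hl, hZ.2⟩
  card_le := h.card_le
  disj j hj := (h.disj j hj).mono_right Set.sdiff_subset
  pairwise := h.pairwise
  conn := h.conn
  conn_left := h.conn_left
  conn_right := h.conn_right

theorem exists_min (h : G.LongLinkage l A B U σ i d) : ∃ n f, G.MinLinkPath A B U n f := by
  obtain ⟨P, hP, hl, -⟩ := h.robust ∅ (by simp)
  obtain ⟨n, f, hf⟩ := hl.exists_linkPath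
  exact (hf.mono hP).exists_min

/-- As `σ j ∪ A` and `σ j ∪ B` are connected, a window untouched by `σ j` would close up to a long
hole. -/
theorem touches_window (h : G.LongLinkage l A B U σ i d) (hno : G.NoHole l) (hl : 3 ≤ l)
    {n : ℕ} {f : ℕ → V} (hf : G.MinLinkPath A B U n f) {a j : ℕ} (ha : a + l ≤ n + 1)
    (hj : j < i) : ∃ k, a ≤ k ∧ k < a + l ∧ ∃ t ∈ σ j, G.Adj t (f k) := by
  refine hf.touches_window hno hl le_rfl ha h.disj_left h.disj_right (T := σ j) ?_ ?_
  · have := (h.conn_left j hj).union (h.conn_right j hj) (by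
      obtain ⟨x, hx⟩ := (h.conn j hj).nonempty
      exact ⟨x, Or.inl hx, Or.inl hx⟩)
    rwa [← Set.union_union_distrib_left, ← Set.union_assoc] at this
  · intro k _ hk hmem
    exact Set.disjoint_left.1 (h.disj j hj) hmem (hf.mem k (by omega))

/-- The first `l` vertices of a shortest link are touched by all `l * s + 1` sets, so one of them
has `s` neighbours in their union. The few such vertices are deleted from `U` beforehand. -/
theorem not_bicliqueFree [Finite V] {s : ℕ} (hno : G.NoHole l) (hl : 3 ≤ l)
    (h : G.LongLinkage l A B U σ (l * s + 1) (s * 2 ^ ((l * s + 1) * (3 * l)))) :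
    ¬ G.BicliqueFree s := by
  classical
  intro hG
  set Y := (Finset.range (l * s + 1)).biUnion σ with hYdef
  have hY : Y.card ≤ (l * s + 1) * (3 * l) := by
    have := Finset.card_biUnion_le_card_mul (Finset.range (l * s + 1)) σ (3 * l)
      (fun i hi => h.card_le i (by simpa using hi))
    simpa using this
  obtain ⟨Z, hZ, hZlight⟩ := hG.exists_few_heavy Y
  have h' := h.sdiff Z (d' := 0)
    (hZ.trans (Nat.mul_le_mul_left _ (Nat.pow_le_pow_right (by norm_num) hY)))
  obtain ⟨n, f, hf⟩ := h'.exists_min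
  have hn := h'.long n f hf.toLinkPath
  obtain ⟨v, hv, hvs⟩ := exists_heavy_of_touches (G := G) (s := s) (c := l) (T := σ)
    (P := (Finset.range l).image f) (Y := Y) (Nat.lt_succ_self (l * s))
    (Finset.card_image_le.trans (by simp)) h.pairwise
    (fun i hi => Finset.subset_biUnion_of_mem σ (by simpa using hi))
    (fun j hj => by
      obtain ⟨k, -, hk, t, ht, hadj⟩ := h'.touches_window hno hl hf (a := 0) (by omega) hj
      exact ⟨t, ht, f k, by simpa using ⟨k, by omega, rfl⟩, hadj⟩)
  obtain ⟨k, hk, rfl⟩ := Finset.mem_image.1 hv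
  rw [Finset.mem_range] at hk
  exact absurd hvs (not_le.2 (hZlight _ (hf.mem k (by omega)).2))

/-- One step: a new small connected set is split off from a shortest link. -/
theorem exists_succ (hno : G.NoHole l) (hl : 3 ≤ l) (h : G.LongLinkage l A B U σ i (3 * l + d))
    (hlong : ∀ n f, G.LinkPath A B U n f → 3 * l < n + 1) :
    ∃ A' B' U' σ', G.LongLinkage l A' B' U' σ' (i + 1) d := by
  classical
  obtain ⟨n, p, hp⟩ := h.exists_min
  have hn := hlong n p hp.toLinkPath
  -- The set `τ` consists of three windows of length `l`. The outer two become the new ends, `τ`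
  -- becomes the new small set, and the middle window keeps the new ends far apart.
  set τ : Finset V := (Finset.range (3 * l)).image p with hτ
  have hτcard : τ.card ≤ 3 * l := Finset.card_image_le.trans (by simp)
  have hmemτ : ∀ k < 3 * l, p k ∈ τ := fun k hk =>
    Finset.mem_image_of_mem p (Finset.mem_range.2 hk)
  have hτU : (τ : Set V) ⊆ U := by
    intro x hx
    obtain ⟨k, hk, rfl⟩ := Finset.mem_image.1 (Finset.mem_coe.1 hx)
    rw [Finset.mem_range] at hk
    exact hp.mem k (by omega)
  have hconn : ∀ a b, a ≤ b → b < 3 * l → G.ConnectedOn (p '' Set.Icc a b) := fun a b hab hb =>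
    connectedOn_image hab fun k _ hk => hp.adj k (by omega)
  have hτconn : G.ConnectedOn (τ : Set V) := by
    convert hconn 0 (3 * l - 1) (by omega) (by omega) using 1
    ext x
    simp only [hτ, Finset.coe_image, Finset.coe_range, Set.mem_image, Set.mem_Iio, Set.mem_Icc]
    constructor
    · rintro ⟨k, hk, rfl⟩
      exact ⟨k, by omega, rfl⟩
    · rintro ⟨k, hk, rfl⟩
      exact ⟨k, by omega, rfl⟩
  have hwin : ∀ a, a + l ≤ 3 * l → p '' Set.Icc a (a + l - 1) ⊆ τ := by
    rintro a ha _ ⟨k, hk, rfl⟩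
    have := hk.2
    exact hmemτ k (by omega)
  -- every link avoiding the new set touches each of its windows
  have htouch : ∀ P ⊆ U, G.IsLink A B P → Disjoint (τ : Set V) P → ∀ a, a + l ≤ 3 * l →
      G.Touches P (p '' Set.Icc a (a + l - 1)) := by
    intro P hPU hP hd a ha
    obtain ⟨j, h1, h2, t, ht, hadj⟩ := hp.touches_window hno hl le_rfl (i := a) (T := P) (by omega)
      h.disj_left h.disj_right
      ((hP.conn.union_of_touches h.left hP.left.symm).union_of_touches h.right
        (hP.right.mono Set.subset_union_left le_rfl))
      (fun j h1 h2 hj => Set.disjoint_left.1 hd (hmemτ j (by omega)) hj)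
    exact ⟨t, ht, p j, ⟨j, ⟨h1, by omega⟩, rfl⟩, hadj⟩
  have hold : ∀ j < i, ∀ a, a + l ≤ 3 * l →
      G.ConnectedOn (σ j ∪ p '' Set.Icc a (a + l - 1)) := by
    intro j hj a ha
    obtain ⟨k, h1, h2, t, ht, hadj⟩ := h.touches_window hno hl hp (a := a) (by omega) hj
    exact (h.conn j hj).union_of_touches (hconn a _ (by omega) (by omega))
      ⟨t, ht, p k, ⟨k, ⟨h1, by omega⟩, rfl⟩, hadj⟩
  refine ⟨p '' Set.Icc 0 (0 + l - 1), p '' Set.Icc (2 * l) (2 * l + l - 1), U \ τ,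
    fun j => if j < i then σ j else τ, ?_⟩
  constructor
  · exact hconn _ _ (by omega) (by omega)
  · exact hconn _ _ (by omega) (by omega)
  · exact Set.disjoint_left.2 fun x hx hx' => hx'.2 (hwin 0 (by omega) hx)
  · exact Set.disjoint_left.2 fun x hx hx' => hx'.2 (hwin _ (by omega) hx)
  · intro m f hf
    obtain ⟨_, ⟨a, ha, rfl⟩, hadj⟩ := hf.left
    obtain ⟨_, ⟨b, hb, rfl⟩, hbdj⟩ := hf.right
    have ha2 := ha.2
    have hb1 := hb.1
    have hb2 := hb.2
    -- reroute the shortest link along `f`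
    have := hp.min (a + 1 + m + 1 + (n - b))
      (fun k => if k ≤ a then p k else if k ≤ a + 1 + m then f (k - (a + 1))
        else p (k - (a + 1 + m + 1) + b))
      ⟨fun k hk => by
        split_ifs with h1 h2
        · exact hp.mem _ (by omega)
        · exact (hf.mem _ (by omega)).1
        · exact hp.mem _ (by omega), fun k hk => by
        rcases lt_trichotomy k a with h1 | rfl | h1
        · rw [if_pos (by omega), if_pos (by omega)]
          exact hp.adj k (by omega)
        · rw [if_pos le_rfl, if_neg (by omega), if_pos (by omega), Nat.sub_self]
          exact hadj
        · rw [if_neg (show ¬ k ≤ a by omega), if_neg (show ¬ k + 1 ≤ a by omega)]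
          rcases lt_trichotomy k (a + 1 + m) with h2 | rfl | h2
          · rw [if_pos (by omega), if_pos (by omega)]
            have := hf.adj (k - (a + 1)) (by omega)
            rwa [show k - (a + 1) + 1 = k + 1 - (a + 1) by omega] at this
          · rw [if_pos le_rfl, if_neg (by omega)]
            simpa using hbdj
          · rw [if_neg (by omega), if_neg (by omega)]
            have := hp.adj (k - (a + 1 + m + 1) + b) (by omega)
            rwa [show k - (a + 1 + m + 1) + b + 1 = k + 1 - (a + 1 + m + 1) + b by omega] at this,
        by simpa using hp.left, by
        rw [if_neg (by omega), if_neg (by omega),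
          show a + 1 + m + 1 + (n - b) - (a + 1 + m + 1) + b = n by omega]
        exact hp.right⟩
    -- Minimality gives `b ≤ a + m + 2`; with `a ≤ l - 1` and `2 * l ≤ b` this is `l ≤ m + 1`.
    omega
  · intro Z hZ
    obtain ⟨P, hPU, hP, hd⟩ := h.robust (τ ∪ Z) ((Finset.card_union_le _ _).trans (by omega))
    rw [Finset.coe_union, Set.disjoint_union_left] at hd
    exact ⟨P, fun x hx => ⟨hPU hx, fun hxZ => Set.disjoint_left.1 hd.1 hxZ hx⟩,
      ⟨hP.conn, (htouch P hPU hP hd.1 0 (by omega)).symm, htouch P hPU hP hd.1 _ (by omega)⟩, hd.2⟩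
  · intro j hj
    split_ifs with h1
    exacts [h.card_le j h1, hτcard]
  · intro j hj
    split_ifs with h1
    · exact (h.disj j h1).mono_right Set.sdiff_subset
    · exact Set.disjoint_left.2 fun x hx hx' => hx'.2 hx
  · intro j k hjk hk
    rw [if_pos (by omega)]
    split_ifs with h1
    · exact h.pairwise j k hjk h1
    · exact Finset.disjoint_coe.1 ((h.disj j (by omega)).mono_right hτU)
  · intro j hj
    split_ifs with h1
    exacts [h.conn j h1, hτconn]
  · intro j hj
    split_ifs with h1
    · exact hold j h1 _ (by omega)
    · rwa [Set.union_eq_self_of_subset_right (hwin 0 (by omega))]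
  · intro j hj
    split_ifs with h1
    · exact hold j h1 _ (by omega)
    · rwa [Set.union_eq_self_of_subset_right (hwin _ (by omega))]

end LongLinkage

/-- In a biclique-free graph without long holes there is no robust long linkage. -/
theorem exists_not_longLinkage (l s : ℕ) (hl : 3 ≤ l) (k i : ℕ) (hik : i + k = l * s + 1) :
    ∃ d : ℕ, ∀ {V : Type u} [Finite V] {G : SimpleGraph V}, G.NoHole l → G.BicliqueFree s →
      ∀ A B U σ, ¬ G.LongLinkage l A B U σ i d := by
  -- `k` counts the sets still to be split off.
  induction k generalizing i with
  | zero =>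
    obtain rfl : i = l * s + 1 := by omega
    exact ⟨_, fun hno hG A B U σ h => h.not_bicliqueFree hno hl hG⟩
  | succ k ih =>
    obtain ⟨d, hd⟩ := ih (i + 1) (by omega)
    obtain ⟨b, hb⟩ := exists_pairwise_anticomplete.{u} s (3 * l) 2
    refine ⟨b + (3 * l + d), fun {V} _ {G} hno hG A B U σ h => ?_⟩
    -- Either two links of at most `3 * l` vertices are anticomplete and form a long hole, or a
    -- bounded set `Z` meets all such links, and its deletion leaves only links long enough to split
    -- off another set.
    by_cases hrob : Robust {P : Finset V | P.card ≤ 3 * l ∧ (P : Set V) ⊆ U ∧ G.IsLink A B P} b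
    · obtain ⟨T, hT, hT'⟩ := hb hG _ (fun P hP => hP.1) hrob
      obtain ⟨-, h0, h0'⟩ := hT 0 (by omega)
      obtain ⟨-, -, h1'⟩ := hT 1 (by omega)
      obtain ⟨hdis, hanti⟩ := hT' 0 1 (by omega) (by omega)
      exact not_noHole_of_two_links hl h.left h.right h0' h1' (h.disj_left.mono_right h0)
        (h.disj_right.mono_right h0) (Finset.disjoint_coe.2 hdis) (fun ht => hanti ht.symm)
        (fun n f hf => h.long n f (hf.mono h0)) hno
    · classical
      unfold Robust at hrob
      push Not at hrob
      obtain ⟨Z, hZ, hZP⟩ := hrob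
      obtain ⟨A', B', U', σ', h'⟩ := (h.sdiff Z (d' := 3 * l + d) (by omega)).exists_succ hno hl (by
        intro n f hf
        by_contra! hn
        have himg : (((Finset.range (n + 1)).image f : Finset V) : Set V) = f '' Set.Icc 0 n := by
          ext x
          simp
        have hsub := hf.image_subset
        refine hZP ((Finset.range (n + 1)).image f)
          ⟨(Finset.card_image_le.trans (by simp)).trans hn, ?_, ?_⟩ ?_
        · rw [himg]
          exact hsub.trans Set.sdiff_subset
        · rw [himg]
          exact hf.isLink
        · rw [← Finset.disjoint_coe, himg]
          exact Set.disjoint_left.2 fun x hx hx' => (hsub hx').2 hx)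
      exact hd hno hG A' B' U' σ' h'

/-! ### Inseparable vertices and short links -/

/-- No set of at most `d` other vertices separates `x` from `y`. -/
def Inseparable (G : SimpleGraph V) (d : ℕ) (x y : V) : Prop :=
  ∀ Z : Finset V, Z.card ≤ d → x ∉ Z → y ∉ Z →
    ∃ C, G.ConnectedOn C ∧ x ∈ C ∧ y ∈ C ∧ Disjoint (Z : Set V) C

/-- The link is the interior of a shortest path in `C`. -/
theorem ConnectedOn.exists_isLink {C : Set V} (hC : G.ConnectedOn C) {x y : V} (hx : x ∈ C)
    (hy : y ∈ C) (hxy : x ≠ y) (hadj : ¬ G.Adj x y) :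
    ∃ P ⊆ C \ {x, y}, G.IsLink {x} {y} P := by
  classical
  have hex : ∃ (n : ℕ) (f : ℕ → V), f 0 = x ∧ f n = y ∧ (∀ i ≤ n, f i ∈ C) ∧
      ∀ i < n, G.Adj (f i) (f (i + 1)) := hC.exists_path hx hy
  obtain ⟨f, h0, hn, hm, ha⟩ := Nat.find_spec hex
  have hmin := fun m h => Nat.find_min' (m := m) hex h
  set n := Nat.find hex
  have hn2 : 2 ≤ n := by
    by_contra! hlt
    interval_cases n
    · exact hxy (h0 ▸ hn)
    · exact hadj (h0 ▸ hn ▸ ha 0 (by omega))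
  refine ⟨f '' Set.Icc 1 (n - 1), ?_, connectedOn_image (by omega) fun k _ hk => ha k (by omega),
    ⟨x, rfl, f 1, ⟨1, ⟨le_rfl, by omega⟩, rfl⟩, h0 ▸ ha 0 (by omega)⟩,
    ⟨f (n - 1), ⟨n - 1, ⟨by omega, le_rfl⟩, rfl⟩, y, rfl, ?_⟩⟩
  · rintro _ ⟨k, ⟨hk1, hk2⟩, rfl⟩
    refine ⟨hm k (by omega), ?_⟩
    rintro (h | h)
    · have := hmin (n - k) ⟨fun i => f (i + k), by simpa using h,
        by simpa [Nat.sub_add_cancel (show k ≤ n by omega)] using hn,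
        fun i hi => hm _ (by omega), fun i hi => by
          have := ha (i + k) (by omega)
          rwa [show i + k + 1 = i + 1 + k by omega] at this⟩
      omega
    · have := hmin k ⟨f, h0, h, fun i hi => hm _ (by omega), fun i hi => ha _ (by omega)⟩
      omega
  · have := ha (n - 1) (by omega)
    rwa [show n - 1 + 1 = n by omega, hn] at this

/-- In a biclique-free graph without long holes, highly inseparable vertices are joined by many
short links. -/
theorem exists_robust_short_links (l s b : ℕ) (hl : 3 ≤ l) : ∃ d : ℕ, ∀ {V : Type u} [Finite V]
    {G : SimpleGraph V}, G.NoHole l → G.BicliqueFree s → ∀ x y, x ≠ y → ¬ G.Adj x y →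
    G.Inseparable d x y → Robust {P : Finset V | P.card ≤ l ∧ G.IsLink {x} {y} P} b := by
  classical
  obtain ⟨d, hd⟩ := exists_not_longLinkage.{u} l s hl (l * s + 1) 0 (by omega)
  refine ⟨d + b, fun {V} _ {G} hno hG x y hxy hadj hins => ?_⟩
  by_contra hrob
  unfold Robust at hrob
  push Not at hrob
  obtain ⟨Z, hZ, hZP⟩ := hrob
  -- Outside a set `Z` that meets all short links, only long ones remain, which start a long linkage
  -- with no sets split off yet.
  refine hd hno hG {x} {y} ((Z : Set V) ∪ {x, y})ᶜ (fun _ => ∅) ?_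
  constructor
  · exact connectedOn_singleton x
  · exact connectedOn_singleton y
  · simp
  · simp
  · intro n f hf
    by_contra! hn
    have himg : (((Finset.range (n + 1)).image f : Finset V) : Set V) = f '' Set.Icc 0 n := by
      ext x
      simp
    refine hZP ((Finset.range (n + 1)).image f)
      ⟨(Finset.card_image_le.trans (by simp)).trans hn.le, ?_⟩ ?_
    · rw [himg]
      exact hf.isLink
    · rw [← Finset.disjoint_coe, himg]
      exact Set.disjoint_left.2 fun v hv hv' => hf.image_subset hv' (Or.inl hv)
  · intro W hW
    obtain ⟨C, hC, hxC, hyC, hd⟩ := hins ((W ∪ Z) \ {x, y})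
      ((Finset.card_le_card Finset.sdiff_subset).trans
        ((Finset.card_union_le _ _).trans (by omega))) (by simp) (by simp)
    obtain ⟨P, hP, hl⟩ := hC.exists_isLink hxC hyC hxy hadj
    have hdis : ∀ v ∈ P, v ∉ W ∧ v ∉ Z := by
      intro v hv
      obtain ⟨h1, h2⟩ := hP hv
      have h3 : v ∉ (W ∪ Z) \ {x, y} := fun h => Set.disjoint_left.1 hd h h1
      simp only [Set.mem_insert_iff, Set.mem_singleton_iff] at h2
      simpa [h2] using h3
    refine ⟨P, fun v hv => ?_, hl, Set.disjoint_left.2 fun v hv hv' => (hdis v hv').1 hv⟩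
    rintro (h | h)
    · exact (hdis v hv).2 h
    · exact (hP hv).2 h
  all_goals simp

/-! ### Ramsey's theorem and free tuples -/

/-- Ramsey's theorem for two colours. -/
theorem exists_isClique_or_isIndepSet (a b : ℕ) : ∃ N : ℕ, ∀ {V : Type u} (G : SimpleGraph V)
    (S : Finset V), N ≤ S.card → (∃ T ⊆ S, T.card = a ∧ G.IsClique T) ∨
      ∃ T ⊆ S, T.card = b ∧ G.IsIndepSet T := by
  classical
  induction hn : a + b generalizing a b with
  | zero =>
    refine ⟨0, fun G S _ => Or.inl ⟨∅, by simp, ?_, by simp⟩⟩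
    rw [Finset.card_empty]
    omega
  | succ n ih =>
    rcases Nat.eq_zero_or_pos a with rfl | ha
    · exact ⟨0, fun G S _ => Or.inl ⟨∅, by simp⟩⟩
    rcases Nat.eq_zero_or_pos b with rfl | hb
    · exact ⟨0, fun G S _ => Or.inr ⟨∅, by simp [IsIndepSet]⟩⟩
    obtain ⟨N₁, h₁⟩ := ih (a - 1) b (by omega)
    obtain ⟨N₂, h₂⟩ := ih a (b - 1) (by omega)
    refine ⟨N₁ + N₂ + 1, fun {V} G S hS => ?_⟩
    obtain ⟨v, hv⟩ := Finset.card_pos.1 (by omega : 0 < S.card)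
    have hsplit := Finset.card_filter_add_card_filter_not (s := S.erase v) (G.Adj v)
    rw [Finset.card_erase_of_mem hv] at hsplit
    rcases Nat.lt_or_ge ((S.erase v).filter (G.Adj v)).card N₁ with hlt | hge
    · rcases h₂ G ((S.erase v).filter fun w => ¬ G.Adj v w) (by omega) with
        ⟨T, hT, hc, hcl⟩ | ⟨T, hT, hc, hi⟩
      · exact Or.inl ⟨T, hT.trans ((Finset.filter_subset _ _).trans (Finset.erase_subset _ _)),
          hc, hcl⟩
      · have hT' : ∀ w ∈ T, w ≠ v ∧ w ∈ S ∧ ¬ G.Adj v w := fun w hw => by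
          simpa [and_assoc] using hT hw
        refine Or.inr ⟨insert v T, ?_, ?_, ?_⟩
        · exact Finset.insert_subset hv fun w hw => (hT' w hw).2.1
        · rw [Finset.card_insert_of_notMem fun h => (hT' v h).1 rfl]
          omega
        · rw [Finset.coe_insert]
          refine Set.Pairwise.insert hi fun w hw _ => ⟨(hT' w hw).2.2, fun h => ?_⟩
          exact (hT' w hw).2.2 h.symm
    · rcases h₁ G _ hge with ⟨T, hT, hc, hcl⟩ | ⟨T, hT, hc, hi⟩
      · have hT' : ∀ w ∈ T, w ≠ v ∧ w ∈ S ∧ G.Adj v w := fun w hw => by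
          simpa [and_assoc] using hT hw
        refine Or.inl ⟨insert v T, ?_, ?_, ?_⟩
        · exact Finset.insert_subset hv fun w hw => (hT' w hw).2.1
        · rw [Finset.card_insert_of_notMem fun h => (hT' v h).1 rfl]
          omega
        · rw [Finset.coe_insert]
          exact Set.Pairwise.insert hcl fun w hw _ => ⟨(hT' w hw).2.2, (hT' w hw).2.2.symm⟩
      · exact Or.inr ⟨T, hT.trans ((Finset.filter_subset _ _).trans (Finset.erase_subset _ _)),
          hc, hi⟩

-- Fixing all coordinates but `k` determines `F (g i) (g j)` and leaves at most `m` values for `g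
-- k`.
open Classical in
theorem card_filter_pi_mem_le {α : Type*} {r m : ℕ} (D : Finset α) (F : α → α → Finset α)
    (hF : ∀ x ∈ D, ∀ y ∈ D, (F x y).card ≤ m) {i j k : Fin r} (hik : i ≠ k) (hjk : j ≠ k) :
    ((Fintype.piFinset fun _ : Fin r => D).filter fun g => g k ∈ F (g i) (g j)).card ≤
      m * D.card ^ (r - 1) := by
  have hcard : (Fintype.piFinset fun _ : {x : Fin r // x ≠ k} => D).card = D.card ^ (r - 1) := by
    simp [Fintype.card_piFinset]
  rw [← hcard]
  refine Finset.card_le_mul_card_image_of_maps_to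
    (f := fun g (x : {x : Fin r // x ≠ k}) => g x.1) ?_ m ?_
  · intro g hg
    simp only [Finset.mem_filter, Fintype.mem_piFinset] at hg ⊢
    exact fun x => hg.1 x.1
  · intro h hh
    rw [Fintype.mem_piFinset] at hh
    refine le_trans ?_ (hF (h ⟨i, hik⟩) (hh _) (h ⟨j, hjk⟩) (hh _))
    refine Finset.card_le_card_of_injOn (fun g => g k) ?_ ?_
    · intro g hg
      simp only [Finset.coe_filter, Finset.mem_filter, Set.mem_ofPred_eq] at hg
      obtain ⟨⟨-, h1⟩, rfl⟩ := hg
      exact h1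
    · intro g hg g' hg' heq
      simp only [Finset.coe_filter, Finset.mem_filter, Set.mem_ofPred_eq] at hg hg'
      funext x
      by_cases hx : x = k
      · rw [hx]
        exact heq
      · exact congrFun (hg.2.trans hg'.2.symm) ⟨x, hx⟩

/-- If a bounded set is assigned to every pair of elements of a large set, some `r` of the elements
avoid the sets assigned to each other. -/
theorem exists_free_tuple (r m : ℕ) : ∃ M : ℕ, ∀ {α : Type u} (D : Finset α)
    (F : α → α → Finset α), M ≤ D.card → (∀ x ∈ D, ∀ y ∈ D, (F x y).card ≤ m) →
    ∃ g : Fin r → α, (∀ i, g i ∈ D) ∧ Function.Injective g ∧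
      ∀ i j k, i ≠ k → j ≠ k → g k ∉ F (g i) (g j) := by
  classical
  rcases Nat.eq_zero_or_pos r with rfl | hr
  · exact ⟨0, fun D F _ _ => ⟨Fin.elim0, fun i => i.elim0, fun i => i.elim0, fun i => i.elim0⟩⟩
  -- Union bound: each of the `r ^ 3` index triples spoils at most a fraction `(m + 1) / D.card` of
  -- all tuples.
  refine ⟨r * r * r * (m + 1) + 1, fun {α} D F hD hF => ?_⟩
  -- Inserting `x` makes injectivity a case of freeness.
  set F' : α → α → Finset α := fun x y => insert x (F x y) with hF'
  set bad : Fin r × Fin r × Fin r → Finset (Fin r → α) := fun t =>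
    if t.1 ≠ t.2.2 ∧ t.2.1 ≠ t.2.2 then
      (Fintype.piFinset fun _ : Fin r => D).filter fun g => g t.2.2 ∈ F' (g t.1) (g t.2.1)
    else ∅ with hbad
  have hbadc : ∀ t ∈ (Finset.univ : Finset (Fin r × Fin r × Fin r)),
      (bad t).card ≤ (m + 1) * D.card ^ (r - 1) := by
    intro t _
    simp only [hbad]
    split_ifs with h
    · exact card_filter_pi_mem_le D F' (fun x hx y hy => (Finset.card_insert_le _ _).trans
        (Nat.succ_le_succ (hF x hx y hy))) h.1 h.2
    · simp
  have hlt : (Finset.univ.biUnion bad).card < (Fintype.piFinset fun _ : Fin r => D).card := by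
    refine (Finset.card_biUnion_le_card_mul _ _ _ hbadc).trans_lt ?_
    have hpos : 0 < D.card ^ (r - 1) := pow_pos (by omega) _
    rw [Fintype.card_piFinset_const]
    conv_rhs => rw [show r = r - 1 + 1 by omega, pow_succ, mul_comm]
    rw [← mul_assoc]
    refine Nat.mul_lt_mul_of_pos_right ?_ hpos
    simp only [Finset.card_univ, Fintype.card_prod, Fintype.card_fin]
    have : r * (r * r) = r * r * r := by ring
    rw [this]
    omega
  obtain ⟨g, hg, hgb⟩ := Finset.exists_mem_notMem_of_card_lt_card hlt
  rw [Fintype.mem_piFinset] at hg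
  have key : ∀ i j k, i ≠ k → j ≠ k → g k ∉ F' (g i) (g j) := by
    intro i j k hik hjk h
    refine hgb (Finset.mem_biUnion.2 ⟨(i, j, k), Finset.mem_univ _, ?_⟩)
    simp only [hbad]
    rw [if_pos ⟨hik, hjk⟩, Finset.mem_filter, Fintype.mem_piFinset]
    exact ⟨hg, h⟩
  refine ⟨g, hg, fun i k hik => ?_, fun i j k hik hjk h =>
    key i j k hik hjk (Finset.mem_insert_of_mem h)⟩
  by_contra hne
  exact key i i k hne hne (by simp [hF', hik])

/-! ### Clean links and cycles through branch vertices -/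

/-- The links between `x` and `y` of size at most `l` that avoid `D` and have no neighbours in `D`
outside `F`. -/
def cleanLinks (G : SimpleGraph V) (l : ℕ) (D F : Finset V) (x y : V) : Set (Finset V) :=
  {P | P.card ≤ l ∧ G.IsLink {x} {y} P ∧ Disjoint P D ∧ ∀ z ∈ D, z ∉ F → ∀ p ∈ P, ¬ G.Adj p z}

/-- If every small `F` fails through some bounded `Z F`, take a link avoiding `D`, the heavy
vertices and `Z F` for all `F ⊆ D`. Its own neighbourhood in `D` is then a small `F` for which it is
clean, although it avoids `Z F`. -/
theorem BicliqueFree.exists_robust_cleanLinks [Finite V] {l s b : ℕ} (hG : G.BicliqueFree s)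
    (D : Finset V) {x y : V}
    (h : Robust {P : Finset V | P.card ≤ l ∧ G.IsLink {x} {y} P}
      (2 ^ D.card * b + D.card + s * 2 ^ D.card)) :
    ∃ F : Finset V, F.card ≤ l * s ∧ Robust (G.cleanLinks l D F x y) b := by
  classical
  by_contra! hcon
  have hcon' : ∀ F : Finset V, ∃ Z : Finset V, Z.card ≤ b ∧
      (F.card ≤ l * s → ∀ P ∈ G.cleanLinks l D F x y, ¬ Disjoint Z P) := by
    intro F
    by_cases hF : F.card ≤ l * s
    · have := hcon F hF
      unfold Robust at this
      push Not at this
      obtain ⟨Z, hZ, hZP⟩ := this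
      exact ⟨Z, hZ, fun _ => hZP⟩
    · exact ⟨∅, by simp, fun h => absurd h hF⟩
  choose Z hZ hZP using hcon'
  obtain ⟨H, hH, hHlight⟩ := hG.exists_few_heavy D
  obtain ⟨P, ⟨hPc, hPl⟩, hd⟩ := h (D.powerset.biUnion Z ∪ D ∪ H) (by
    refine (Finset.card_union_le _ _).trans (add_le_add ?_ hH)
    refine (Finset.card_union_le _ _).trans (add_le_add ?_ le_rfl)
    rw [← Finset.card_powerset]
    exact Finset.card_biUnion_le_card_mul _ _ _ fun F _ => hZ F)
  rw [Finset.disjoint_union_left, Finset.disjoint_union_left] at hd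
  set F := D.filter fun z => ∃ p ∈ P, G.Adj p z with hF
  have hFc : F.card ≤ l * s := by
    calc F.card ≤ (P.biUnion fun p => D.filter (G.Adj p)).card := Finset.card_le_card fun z hz => by
          simpa [hF, and_left_comm] using hz
      _ ≤ P.card * s := Finset.card_biUnion_le_card_mul _ _ _ fun p hp =>
          (hHlight p fun h => Finset.disjoint_left.1 hd.2 h hp).le
      _ ≤ l * s := Nat.mul_le_mul_right _ hPc
  refine hZP F hFc P ⟨hPc, hPl, hd.1.2.symm, fun z hz hzF p hp hadj => hzF ?_⟩ ?_
  · exact Finset.mem_filter.2 ⟨hz, p, hp, hadj⟩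
  · exact hd.1.1.mono_left (Finset.subset_biUnion_of_mem Z
      (Finset.mem_powerset.2 (Finset.filter_subset _ _)))

/-- The part of a cyclic chain of links strictly between the first and the last branch vertex. -/
def chainSet (x : ℕ → V) (L : ℕ → Finset V) (m : ℕ) : Set V :=
  {v | (∃ i ≤ m, v ∈ L i) ∨ ∃ i, 0 < i ∧ i ≤ m ∧ v = x i}

theorem connectedOn_chainSet {x : ℕ → V} {L : ℕ → Finset V} {m : ℕ}
    (hL : ∀ i ≤ m, G.IsLink {x i} {x (i + 1)} (L i)) : G.ConnectedOn (chainSet x L m) := by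
  induction m with
  | zero =>
    convert (hL 0 le_rfl).conn using 1
    ext v
    simp only [chainSet, Set.mem_ofPred_eq, Finset.mem_coe]
    constructor
    · rintro (⟨i, hi, h⟩ | ⟨i, h1, h2, -⟩)
      · rwa [Nat.le_zero.1 hi] at h
      · omega
    · exact fun h => Or.inl ⟨0, le_rfl, h⟩
  | succ m ih =>
    have h1 := ih fun i hi => hL i (by omega)
    obtain ⟨a, ha, _, rfl, hadj⟩ := (hL m (by omega)).right
    have h2 := h1.insert_of_adj (a := a) (Or.inl ⟨m, le_rfl, ha⟩) hadj
    have h3 := h2.union_of_touches (hL (m + 1) le_rfl).conn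
      ((hL (m + 1) le_rfl).left.mono (by simp) le_rfl)
    convert h3 using 1
    ext v
    simp only [chainSet, Set.mem_ofPred_eq, Finset.mem_coe, Set.mem_union, Set.mem_insert_iff]
    constructor
    · rintro (⟨i, hi, h⟩ | ⟨i, h1, h2, h⟩)
      · rcases Nat.lt_or_ge m i with hlt | hge
        · right
          rwa [show m + 1 = i by omega]
        · exact Or.inl (Or.inr (Or.inl ⟨i, hge, h⟩))
      · rcases Nat.lt_or_ge m i with hlt | hge
        · left; left
          rw [h, show m + 1 = i by omega]
        · exact Or.inl (Or.inr (Or.inr ⟨i, h1, hge, h⟩))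
    · rintro ((h | ⟨i, hi, h⟩ | ⟨i, h1, h2, h⟩) | h)
      · exact Or.inr ⟨m + 1, by omega, le_rfl, h⟩
      · exact Or.inl ⟨i, by omega, h⟩
      · exact Or.inr ⟨i, h1, by omega, h⟩
      · exact Or.inl ⟨m + 1, le_rfl, h⟩

/-- Independent vertices joined in a cyclic order by disjoint, anticomplete and clean links yield a
long induced cycle. -/
theorem not_noHole_of_cyclic_links {l : ℕ} (hl : 3 ≤ l) {x : ℕ → V} {L : ℕ → Finset V}
    (hind : ∀ i j, i < l → j < l → ¬ G.Adj (x i) (x j))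
    (hne : ∀ i j, i < l → j < l → i ≠ j → x i ≠ x j)
    (hL : ∀ i, i + 1 < l → G.IsLink {x i} {x (i + 1)} (L i))
    (hLl : G.IsLink {x 0} {x (l - 1)} (L (l - 1)))
    (hLx : ∀ i j, i < l → j < l → x j ∉ L i)
    (hclean : ∀ i j, i + 1 < l → j < l → j ≠ i → j ≠ i + 1 → ∀ p ∈ L i, ¬ G.Adj p (x j))
    (hcleanl : ∀ j, 0 < j → j + 1 < l → ∀ p ∈ L (l - 1), ¬ G.Adj p (x j))
    (hdisj : ∀ i j, i < j → j < l → Disjoint (L i) (L j) ∧ ¬ G.Touches (L i : Set V) (L j)) :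
    ¬ G.NoHole l := by
  have hanti : ∀ i j, i < l → j < l → i ≠ j → ∀ p ∈ L i, ∀ q ∈ L j, ¬ G.Adj p q := by
    intro i j hi hj hij p hp q hq hadj
    rcases Nat.lt_or_gt_of_ne hij with h | h
    · exact (hdisj i j h hj).2 ⟨p, hp, q, hq, hadj⟩
    · exact (hdisj j i h hi).2 ⟨q, hq, p, hp, hadj.symm⟩
  -- The first `l - 1` links are strung together to one long link between `x 0` and `x (l - 1)`; the
  -- last link returns.
  refine not_noHole_of_two_links hl (connectedOn_singleton (x 0)) (connectedOn_singleton (x (l - 1)))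
    (P₁ := chainSet x L (l - 2)) (P₂ := L (l - 1)) ⟨?_, ?_, ?_⟩ hLl ?_ ?_ ?_ ?_ ?_
  · exact connectedOn_chainSet fun i hi => hL i (by omega)
  · exact (hL 0 (by omega)).left.mono le_rfl fun v hv => Or.inl ⟨0, by omega, hv⟩
  · have := (hL (l - 2) (by omega)).right
    rw [show l - 2 + 1 = l - 1 by omega] at this
    exact this.mono (fun v hv => Or.inl ⟨l - 2, le_rfl, hv⟩) le_rfl
  · rw [Set.disjoint_singleton_left]
    rintro (⟨i, hi, h⟩ | ⟨i, h1, h2, h⟩)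
    · exact hLx i 0 (by omega) (by omega) h
    · exact hne 0 i (by omega) (by omega) (by omega) h
  · rw [Set.disjoint_singleton_left]
    rintro (⟨i, hi, h⟩ | ⟨i, h1, h2, h⟩)
    · exact hLx i _ (by omega) (by omega) h
    · exact hne _ i (by omega) (by omega) (by omega) h
  · rw [Set.disjoint_left]
    rintro v (⟨i, hi, h⟩ | ⟨i, h1, h2, rfl⟩) hv
    · exact Finset.disjoint_left.1 (hdisj i (l - 1) (by omega) (by omega)).1 h hv
    · exact hLx _ i (by omega) (by omega) hv
  · rintro ⟨p, hp, v, ⟨i, hi, h⟩ | ⟨i, h1, h2, rfl⟩, hadj⟩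
    · exact hanti _ _ (by omega) (by omega) (by omega) p hp v h hadj
    · exact hcleanl i h1 (by omega) p hp hadj
  · intro n f hf
    -- Give `L i` the position `2 * i` and `x i` the position `2 * i - 1`. A step of the walk
    -- advances by at most one position, and the walk must end in `L (l - 2)`.
    have key : ∀ k ≤ n, (∃ i ≤ l - 2, f k ∈ L i ∧ 2 * i ≤ k) ∨
        ∃ i, 0 < i ∧ i ≤ l - 2 ∧ f k = x i ∧ 2 * i ≤ k + 1 := by
      intro k
      induction k with
      | zero =>
        intro _
        obtain ⟨_, rfl, hadj⟩ := hf.left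
        rcases hf.mem 0 (by omega) with ⟨i, hi, h⟩ | ⟨i, h1, h2, h⟩
        · have : i = 0 := by
            by_contra hi0
            exact hclean i 0 (by omega) (by omega) (by omega) (by omega) _ h hadj.symm
          exact Or.inl ⟨i, hi, h, by omega⟩
        · rw [h] at hadj
          exact absurd hadj (hind _ _ (by omega) (by omega))
      | succ k ih =>
        intro hk
        have hadj := hf.adj k (by omega)
        rcases ih (by omega) with ⟨i, hi, h, hik⟩ | ⟨i, hi0, hi, h, hik⟩ <;>
          rcases hf.mem (k + 1) hk with ⟨j, hj, h'⟩ | ⟨j, hj0, hj, h'⟩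
        · have : i = j := by
            by_contra hij
            exact hanti _ _ (by omega) (by omega) hij _ h _ h' hadj
          exact Or.inl ⟨j, hj, h', by omega⟩
        · have : j = i ∨ j = i + 1 := by
            by_contra! hij
            rw [h'] at hadj
            exact hclean i j (by omega) (by omega) hij.1 hij.2 _ h hadj
          exact Or.inr ⟨j, hj0, hj, h', by omega⟩
        · have : i = j ∨ i = j + 1 := by
            by_contra! hij
            rw [h] at hadj
            exact hclean j i (by omega) (by omega) hij.1 hij.2 _ h' hadj.symm
          exact Or.inl ⟨j, hj, h', by omega⟩
        · rw [h, h'] at hadj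
          exact absurd hadj (hind _ _ (by omega) (by omega))
    obtain ⟨_, rfl, hadj⟩ := hf.right
    rcases key n le_rfl with ⟨i, hi, h, hin⟩ | ⟨i, hi0, hi, h, hin⟩
    · have : i = l - 2 := by
        by_contra hi2
        exact hclean i (l - 1) (by omega) (by omega) (by omega) (by omega) _ h hadj
      omega
    · rw [h] at hadj
      exact absurd hadj (hind _ _ (by omega) (by omega))

theorem BicliqueFree.not_isClique {s : ℕ} (hG : G.BicliqueFree s) {T : Finset V}
    (hT : T.card = 2 * s) : ¬ G.IsClique T := by
  classical
  intro hcl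
  obtain ⟨S, hS, hSc⟩ := Finset.exists_subset_card_eq (show s ≤ T.card by omega)
  refine hG S (T \ S) hSc (by rw [Finset.card_sdiff_of_subset hS]; omega) fun a ha b hb => ?_
  rw [Finset.mem_sdiff] at hb
  exact hcl (hS ha) hb.1 fun h => hb.2 (h ▸ ha)

/-- A biclique-free graph without long holes has no large set of pairwise highly inseparable
vertices. -/
theorem exists_not_pairwise_inseparable (l s : ℕ) (hl : 3 ≤ l) : ∃ M d : ℕ,
    ∀ {V : Type u} [Finite V] {G : SimpleGraph V}, G.NoHole l → G.BicliqueFree s →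
    ∀ D : Finset V, (∀ x ∈ D, ∀ y ∈ D, x ≠ y → G.Inseparable d x y) → D.card < M := by
  classical
  obtain ⟨b, hb⟩ := exists_pairwise_anticomplete.{u} s (l * l * l) l
  obtain ⟨m, hm⟩ := exists_free_tuple.{u} l (l * s)
  obtain ⟨N, hN⟩ := exists_isClique_or_isIndepSet.{u} (2 * s) m
  obtain ⟨d, hd⟩ := exists_robust_short_links.{u} l s (2 ^ m * b + m + s * 2 ^ m) hl
  refine ⟨N, d, fun {V} _ {G} hno hG D₀ hD₀ => ?_⟩
  by_contra! hcard
  rcases hN G D₀ hcard with ⟨T, -, hT, hcl⟩ | ⟨D, hDD, hDc, hind⟩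
  · exact hG.not_isClique hT hcl
  have hnadj : ∀ x ∈ D, ∀ y ∈ D, ¬ G.Adj x y := fun x hx y hy hadj => hind hx hy hadj.ne hadj
  have hF : ∀ x y, ∃ F : Finset V, F.card ≤ l * s ∧
      (x ∈ D → y ∈ D → x ≠ y → Robust (G.cleanLinks l D F x y) b) := by
    intro x y
    by_cases h : x ∈ D ∧ y ∈ D ∧ x ≠ y
    · obtain ⟨hx, hy, hxy⟩ := h
      have h1 := hd hno hG x y hxy (hnadj x hx y hy) (hD₀ x (hDD hx) y (hDD hy) hxy)
      obtain ⟨F, h2, h3⟩ := hG.exists_robust_cleanLinks (b := b) D (hDc ▸ h1)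
      exact ⟨F, h2, fun _ _ _ => h3⟩
    · exact ⟨∅, by simp, fun h1 h2 h3 => absurd ⟨h1, h2, h3⟩ h⟩
  choose F hFc hFr using hF
  obtain ⟨g, hgD, hginj, hgF⟩ := hm D F hDc.ge fun x _ y _ => hFc x y
  set x : ℕ → V := fun i => if h : i < l then g ⟨i, h⟩ else g ⟨0, by omega⟩ with hx
  have hxD : ∀ i, x i ∈ D := fun i => by
    simp only [hx]
    split_ifs <;> exact hgD _
  have hxne : ∀ i j, i < l → j < l → i ≠ j → x i ≠ x j := by
    intro i j hi hj hij h
    simp only [hx, dif_pos hi, dif_pos hj] at h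
    exact hij (congrArg Fin.val (hginj h))
  have hxF : ∀ i j k, i < l → j < l → k < l → k ≠ i → k ≠ j → x k ∉ F (x i) (x j) := by
    intro i j k hi hj hk hki hkj
    simp only [hx, dif_pos hi, dif_pos hj, dif_pos hk]
    exact hgF _ _ _ (fun h => hki (congrArg Fin.val h).symm)
      (fun h => hkj (congrArg Fin.val h).symm)
  -- a single bounded set containing clean links for all pairs
  obtain ⟨T, hT, hTd⟩ := hb hG {T : Finset V | T.card ≤ l * l * l ∧ ∀ i j, i < j → j < l →
      ∃ P ⊆ T, P ∈ G.cleanLinks l D (F (x i) (x j)) (x i) (x j)} (fun T h => h.1) (by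
    intro Z hZ
    have hP : ∀ i j, ∃ P : Finset V, P.card ≤ l ∧ Disjoint Z P ∧ (i < j → j < l →
        P ∈ G.cleanLinks l D (F (x i) (x j)) (x i) (x j)) := by
      intro i j
      by_cases hij : i < j ∧ j < l
      · obtain ⟨P, hP, hPZ⟩ := hFr (x i) (x j) (hxD i) (hxD j)
          (hxne i j (by omega) hij.2 (by omega)) Z hZ
        exact ⟨P, hP.1, hPZ, fun _ _ => hP⟩
      · exact ⟨∅, by simp, by simp, fun h1 h2 => absurd ⟨h1, h2⟩ hij⟩
    choose P hPc hPZ hP using hP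
    refine ⟨(Finset.range l ×ˢ Finset.range l).biUnion fun t => P t.1 t.2, ⟨?_, ?_⟩, ?_⟩
    · refine (Finset.card_biUnion_le_card_mul _ _ l fun t _ => hPc _ _).trans ?_
      simp
    · intro i j hij hj
      exact ⟨P i j, Finset.subset_biUnion_of_mem (fun t : ℕ × ℕ => P t.1 t.2) (x := (i, j))
        (by simp; omega), hP i j hij hj⟩
    · rw [Finset.disjoint_biUnion_right]
      exact fun t _ => hPZ _ _)
  -- Every `T i` contains links for all pairs, so it can serve any side of the cycle: here the side
  -- from `x i` to the next branch vertex, or the closing side if `i + 1 = l`.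
  have hL : ∀ i, ∃ L : Finset V, i < l → L ⊆ T i ∧
      (i + 1 < l → L ∈ G.cleanLinks l D (F (x i) (x (i + 1))) (x i) (x (i + 1))) ∧
      (i + 1 = l → L ∈ G.cleanLinks l D (F (x 0) (x i)) (x 0) (x i)) := by
    intro i
    by_cases h1 : i + 1 < l
    · obtain ⟨P, h2, h3⟩ := (hT i (by omega)).2 i (i + 1) (by omega) h1
      exact ⟨P, fun _ => ⟨h2, fun _ => h3, fun h => by omega⟩⟩
    · by_cases h2 : i + 1 = l
      · obtain ⟨P, h3, h4⟩ := (hT i (by omega)).2 0 i (by omega) (by omega)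
        exact ⟨P, fun _ => ⟨h3, fun h => absurd h h1, fun _ => h4⟩⟩
      · exact ⟨∅, fun h => by omega⟩
  choose L hL using hL
  have hLD : ∀ i < l, Disjoint (L i) D := by
    intro i hi
    by_cases h1 : i + 1 < l
    · exact ((hL i hi).2.1 h1).2.2.1
    · exact ((hL i hi).2.2 (by omega)).2.2.1
  have hLl := (hL (l - 1) (by omega)).2.2 (by omega)
  refine not_noHole_of_cyclic_links hl (x := x) (L := L)
    (fun i j _ _ => hnadj _ (hxD i) _ (hxD j)) hxne (fun i hi => ((hL i (by omega)).2.1 hi).2.1)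
    hLl.2.1 ?_ ?_ ?_ ?_ hno
  · exact fun i j hi _ h => Finset.disjoint_left.1 (hLD i hi) h (hxD j)
  · intro i j hi hj h1 h2 p hp
    exact ((hL i (by omega)).2.1 hi).2.2.2 _ (hxD j)
      (hxF i (i + 1) j (by omega) hi hj h1 h2) p hp
  · intro j h1 h2 p hp
    exact hLl.2.2.2 _ (hxD j)
      (hxF 0 (l - 1) j (by omega) (by omega) (by omega) (by omega) (by omega)) p hp
  · intro i j hij hj
    obtain ⟨h1, h2⟩ := hTd i j hij hj
    have h3 := (hL i (by omega)).1
    have h4 := (hL j hj).1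
    exact ⟨h1.mono h3 h4, fun h => h2 (h.mono (Finset.coe_subset.2 h3) (Finset.coe_subset.2 h4))⟩

/-! ### Balls in graphs without long holes -/

/-- The vertices at distance at most `n` from `x` when all steps lead into `R`. -/
def ballIn (G : SimpleGraph V) (R : Set V) (x : V) : ℕ → Set V
  | 0 => {x}
  | n + 1 => ballIn G R x n ∪ {v | v ∈ R ∧ ∃ u ∈ ballIn G R x n, G.Adj u v}

theorem ballIn_mono (R : Set V) (x : V) : Monotone (G.ballIn R x) :=
  monotone_nat_of_le_succ fun _ => Set.subset_union_left

theorem mem_ballIn_self (R : Set V) (x : V) (n : ℕ) : x ∈ G.ballIn R x n :=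
  ballIn_mono R x (Nat.zero_le n) rfl

theorem mem_ballIn_succ {R : Set V} {x u v : V} {n : ℕ} (hu : u ∈ G.ballIn R x n)
    (hv : v ∈ R) (huv : G.Adj u v) : v ∈ G.ballIn R x (n + 1) := Or.inr ⟨hv, u, hu, huv⟩

theorem ballIn_subset {R : Set V} {x : V} (hx : x ∈ R) (n : ℕ) : G.ballIn R x n ⊆ R := by
  induction n with
  | zero => simpa [ballIn] using hx
  | succ n ih => exact Set.union_subset ih fun v hv => hv.1

theorem connectedOn_ballIn (R : Set V) (x : V) (n : ℕ) : G.ConnectedOn (G.ballIn R x n) := by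
  induction n with
  | zero => exact connectedOn_singleton x
  | succ n ih =>
    refine induce_connected_of_patches x (mem_ballIn_self R x (n + 1)) fun {v} hv => ?_
    rcases hv with hv | ⟨hvR, u, hu, huv⟩
    · exact ⟨_, Set.subset_union_left, mem_ballIn_self R x n, hv, ih.preconnected _ _⟩
    · refine ⟨insert v (G.ballIn R x n), ?_, Or.inr (mem_ballIn_self R x n), Or.inl rfl,
        (ih.insert_of_adj hu huv).preconnected _ _⟩
      exact Set.insert_subset (mem_ballIn_succ hu hvR huv) Set.subset_union_left

/-- A connected set meeting both `K` and its complement contains an edge leaving `K`. -/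
theorem ConnectedOn.exists_adj_exit {S K : Set V} (hS : G.ConnectedOn S) {a b : V} (ha : a ∈ S)
    (hb : b ∈ S) (haK : a ∈ K) (hbK : b ∉ K) : ∃ u ∈ S, ∃ v ∈ S, u ∈ K ∧ v ∉ K ∧ G.Adj u v := by
  obtain ⟨n, f, h0, hn, hm, hadj⟩ := hS.exists_path ha hb
  by_contra! hcon
  have : ∀ i ≤ n, f i ∈ K := by
    intro i
    induction i with
    | zero => exact fun _ => h0 ▸ haK
    | succ i ih =>
      intro hi
      by_contra hK
      exact hcon _ (hm i (by omega)) _ (hm _ hi) (ih (by omega)) hK (hadj i (by omega))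
  exact hbK (hn ▸ this n le_rfl)

/-- A connected set in `R` lies in a component of `R`. -/
theorem ConnectedOn.exists_component {C R : Set V} (hC : G.ConnectedOn C) (hCR : C ⊆ R) :
    ∃ K, C ⊆ K ∧ K ⊆ R ∧ G.ConnectedOn K ∧ ∀ u ∈ K, ∀ v ∈ R, G.Adj u v → v ∈ K := by
  set 𝓢 : Set (Set V) := {S | G.ConnectedOn S ∧ S ⊆ R ∧ C ⊆ S} with h𝓢
  have hC𝓢 : C ∈ 𝓢 := ⟨hC, hCR, le_rfl⟩
  have hCK : C ⊆ ⋃₀ 𝓢 := Set.subset_sUnion_of_mem hC𝓢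
  have hK : G.ConnectedOn (⋃₀ 𝓢) := by
    refine induce_sUnion_connected_of_pairwise_not_disjoint ⟨C, hC𝓢⟩ ?_ fun h => h.1
    intro S T hS hT
    obtain ⟨c, hc⟩ := hC.nonempty
    exact ⟨c, hS.2.2 hc, hT.2.2 hc⟩
  have hKR : ⋃₀ 𝓢 ⊆ R := Set.sUnion_subset fun S hS => hS.2.1
  refine ⟨⋃₀ 𝓢, hCK, hKR, hK, fun u hu v hv huv => ?_⟩
  exact Set.mem_sUnion.2 ⟨insert v (⋃₀ 𝓢), ⟨hK.insert_of_adj hu huv, Set.insert_subset hv hKR,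
    hCK.trans (Set.subset_insert _ _)⟩, Set.mem_insert _ _⟩

/-- In a graph without long holes, two neighbours of a connected set avoiding a ball that lie on
the boundary of this ball are close to each other. -/
theorem NoHole.mem_ballIn_of_boundary {l : ℕ} (hno : G.NoHole l) (hl : 3 ≤ l) {R K : Set V} {v₀ : V}
    (hv₀ : v₀ ∈ R) {j : ℕ} (hK : G.ConnectedOn K) (hKR : K ⊆ R)
    (hKB : Disjoint K (G.ballIn R v₀ j)) {x y : V} (hx : x ∈ G.ballIn R v₀ j)
    (hy : y ∈ G.ballIn R v₀ j) (hxK : G.Touches {x} K) (hyK : G.Touches K {y}) :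
    y ∈ G.ballIn R x l := by
  by_cases hxy : x = y
  · exact hxy ▸ mem_ballIn_self R x l
  have hyR := ballIn_subset hv₀ j hy
  by_cases hadj : G.Adj x y
  · exact ballIn_mono R x (show 1 ≤ l by omega)
      (mem_ballIn_succ (n := 0) (mem_ballIn_self R x 0) hyR hadj)
  rcases Nat.eq_zero_or_pos j with rfl | hj
  · exact absurd (hx.trans hy.symm) hxy
  obtain ⟨j, rfl⟩ := Nat.exists_eq_add_of_le' hj
  have hinner : ∀ u ∈ G.ballIn R v₀ j, ∀ v ∈ K, ¬ G.Adj u v := fun u hu v hv huv =>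
    Set.disjoint_left.1 hKB hv (mem_ballIn_succ hu (hKR hv) huv)
  have hlower : ∀ z ∈ G.ballIn R v₀ (j + 1), G.Touches {z} K →
      G.Touches {z} (G.ballIn R v₀ j) := by
    rintro z (hz | ⟨-, u, hu, huz⟩) ⟨_, rfl, v, hv, hzv⟩
    · exact absurd hzv (hinner _ hz v hv)
    · exact ⟨_, rfl, u, hu, huz.symm⟩
  -- `K` and the ball of radius `j` are anticomplete links between `x` and `y`, and the former is
  -- long if `y` is far from `x`.
  by_contra hfar
  refine not_noHole_of_two_links hl (connectedOn_singleton x) (connectedOn_singleton y)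
    ⟨hK, hxK, hyK⟩ ⟨connectedOn_ballIn R v₀ j, hlower x hx hxK, (hlower y hy hyK.symm).symm⟩
    ?_ ?_ ?_ ?_ ?_ hno
  · exact Set.disjoint_singleton_left.2 fun h => Set.disjoint_left.1 hKB h hx
  · exact Set.disjoint_singleton_left.2 fun h => Set.disjoint_left.1 hKB h hy
  · exact hKB.mono_right (ballIn_mono R v₀ (Nat.le_succ j))
  · rintro ⟨u, hu, v, hv, huv⟩
    exact hinner u hu v hv huv
  · intro n f hf
    by_contra! hn
    have hfk : ∀ k ≤ n, f k ∈ G.ballIn R x (k + 1) := by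
      intro k
      induction k with
      | zero =>
        intro _
        obtain ⟨_, rfl, h⟩ := hf.left
        exact mem_ballIn_succ (mem_ballIn_self R _ 0) (hKR (hf.mem 0 (by omega))) h
      | succ k ih =>
        exact fun hk => mem_ballIn_succ (ih (by omega)) (hKR (hf.mem _ hk)) (hf.adj k (by omega))
    obtain ⟨_, rfl, h⟩ := hf.right
    exact hfar (ballIn_mono R x (show n + 1 + 1 ≤ l by omega)
      (mem_ballIn_succ (hfk n le_rfl) hyR h))

/-- In a graph without long holes, pairwise intersecting connected sets are all met by a single
ball of bounded radius. -/
theorem NoHole.exists_ball_meeting [Finite V] {l : ℕ} (hno : G.NoHole l) (hl : 3 ≤ l) {R : Set V}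
    {𝓑 : Set (Set V)} (hne : 𝓑.Nonempty) (hconn : ∀ C ∈ 𝓑, G.ConnectedOn C)
    (hR : ∀ C ∈ 𝓑, C ⊆ R) (hinter : ∀ C ∈ 𝓑, ∀ C' ∈ 𝓑, (C ∩ C').Nonempty) :
    ∃ x ∈ R, ∀ C ∈ 𝓑, ¬ Disjoint C (G.ballIn R x (l + 1)) := by
  classical
  by_contra! hcon
  obtain ⟨C₀, hC₀⟩ := hne
  obtain ⟨v₀, hv₀⟩ := (hconn C₀ hC₀).nonempty
  have hv₀R := hR C₀ hC₀ hv₀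
  have hreach : ∀ C, ∃ n, C ∈ 𝓑 → ¬ Disjoint C (G.ballIn R v₀ n) := by
    intro C
    by_cases hC : C ∈ 𝓑
    · obtain ⟨c, hc, hc₀⟩ := hinter C hC C₀ hC₀
      obtain ⟨n, f, h0, hn, hm, hadj⟩ := (hconn C₀ hC₀).exists_path hv₀ hc₀
      have hfk : ∀ k ≤ n, f k ∈ G.ballIn R v₀ k := by
        intro k
        induction k with
        | zero => exact fun _ => h0
        | succ k ih =>
          exact fun hk => mem_ballIn_succ (ih (by omega)) (hR C₀ hC₀ (hm _ hk)) (hadj k (by omega))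
      exact ⟨n, fun _ h => Set.disjoint_left.1 h hc (hn ▸ hfk n le_rfl)⟩
    · exact ⟨0, fun h => absurd h hC⟩
  choose N hN using hreach
  have hex : ∃ j, ∀ C ∈ 𝓑, ¬ Disjoint C (G.ballIn R v₀ j) := by
    obtain ⟨j, hj⟩ := (Set.toFinite (Set.range N)).bddAbove
    exact ⟨j, fun C hC h => hN C hC (h.mono_right (ballIn_mono R v₀ (hj ⟨C, rfl⟩)))⟩
  have hj := Nat.find_spec hex
  have hj0 : Nat.find hex ≠ 0 := by
    intro h0
    rw [h0] at hj
    obtain ⟨C, hC, hd⟩ := hcon v₀ hv₀R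
    exact hj C hC (hd.mono_right (ballIn_mono R v₀ (Nat.zero_le _)))
  obtain ⟨j, hjs⟩ := Nat.exists_eq_succ_of_ne_zero hj0
  have hjmin := Nat.find_min hex (m := j) (by omega)
  rw [hjs] at hj
  push Not at hjmin
  obtain ⟨C, hC, hCd⟩ := hjmin
  -- `C` misses the ball of radius `j`, while all members meet that of radius `j + 1`. The
  -- neighbours in the smaller ball of the component `K` around `C` are all close to one of them,
  -- `x`.
  obtain ⟨K, hCK, hKRB, hK, hKmax⟩ := (hconn C hC).exists_component
    (R := R \ G.ballIn R v₀ j) fun c hc => ⟨hR C hC hc, Set.disjoint_left.1 hCd hc⟩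
  have hKR : K ⊆ R := fun v hv => (hKRB hv).1
  have hKB : Disjoint K (G.ballIn R v₀ j) := Set.disjoint_left.2 fun v hv => (hKRB hv).2
  have hbd : ∀ y ∈ K, y ∈ G.ballIn R v₀ (j + 1) → ∃ u ∈ G.ballIn R v₀ j, G.Adj u y := by
    rintro y hyK (hy | ⟨-, h⟩)
    · exact absurd hy (Set.disjoint_left.1 hKB hyK)
    · exact h
  obtain ⟨y, hyC, hyB⟩ := Set.not_disjoint_iff.1 (hj C hC)
  obtain ⟨x, hxB, hxy⟩ := hbd y (hCK hyC) hyB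
  obtain ⟨Cx, hCx, hCxd⟩ := hcon x (ballIn_subset hv₀R j hxB)
  obtain ⟨c, hcx, hcC⟩ := hinter Cx hCx C hC
  obtain ⟨z, hzC, hzB⟩ := Set.not_disjoint_iff.1 (hj Cx hCx)
  have hclose : ∀ w ∈ G.ballIn R v₀ j, G.Touches K {w} → w ∈ G.ballIn R x l := fun w hw hwK =>
    hno.mem_ballIn_of_boundary hl hv₀R hK hKR hKB hxB hw ⟨x, rfl, y, hCK hyC, hxy⟩ hwK
  -- `Cx` meets `K` and the ball of radius `j + 1`. Whether it does the latter inside `K` or after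
  -- leaving `K`, it comes within `l + 1` of `x`.
  by_cases hzK : z ∈ K
  · obtain ⟨w, hwB, hwz⟩ := hbd z hzK hzB
    exact Set.disjoint_left.1 hCxd hzC
      (mem_ballIn_succ (hclose w hwB ⟨z, hzK, w, rfl, hwz.symm⟩) (hR Cx hCx hzC) hwz)
  · obtain ⟨u, -, w, hwC, huK, hwK, huw⟩ := (hconn Cx hCx).exists_adj_exit hcx hzC (hCK hcC) hzK
    have hwB : w ∈ G.ballIn R v₀ j := by
      by_contra h
      exact hwK (hKmax u huK w ⟨hR Cx hCx hwC, h⟩ huw)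
    exact Set.disjoint_left.1 hCxd hwC
      (ballIn_mono R x (Nat.le_succ l) (hclose w hwB ⟨u, huK, w, rfl, huw⟩))

/-! ### Separating balls and hitting sets -/

/-- A vertex of a ball is reached while avoiding `Z`, or from some vertex of `Z`. -/
theorem mem_ballIn_cases {R Z : Set V} {x y : V} (hx : x ∉ Z) (hxR : x ∈ R) {n : ℕ}
    (hy : y ∈ G.ballIn R x (n + 1)) : (∃ T, G.ConnectedOn T ∧ x ∈ T ∧ y ∈ T ∧ Disjoint Z T) ∨
      ∃ z ∈ Z, z ∈ R ∧ y ∈ G.ballIn R z n := by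
  have hstep : ∀ T, G.ConnectedOn T → x ∈ T → Disjoint Z T → ∀ u ∈ T, ∀ y ∈ R, G.Adj u y → ∀ n,
      (∃ T, G.ConnectedOn T ∧ x ∈ T ∧ y ∈ T ∧ Disjoint Z T) ∨
        ∃ z ∈ Z, z ∈ R ∧ y ∈ G.ballIn R z n := by
    intro T hT hxT hd u hu y hyR huy n
    by_cases hyZ : y ∈ Z
    · exact Or.inr ⟨y, hyZ, hyR, mem_ballIn_self R y n⟩
    · exact Or.inl ⟨insert y T, hT.insert_of_adj hu huy, Or.inr hxT, Or.inl rfl,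
        Set.disjoint_insert_right.2 ⟨hyZ, hd⟩⟩
  have hx0 : ∃ T, G.ConnectedOn T ∧ x ∈ T ∧ x ∈ T ∧ Disjoint Z T :=
    ⟨{x}, connectedOn_singleton x, rfl, rfl, Set.disjoint_singleton_right.2 hx⟩
  induction n generalizing y with
  | zero =>
    rcases hy with hy | ⟨hyR, u, hu, huy⟩
    · obtain rfl : y = x := hy
      exact Or.inl hx0
    · obtain rfl : u = x := hu
      obtain ⟨T, hT, huT, -, hd⟩ := hx0
      exact hstep T hT huT hd u huT y hyR huy 0
  | succ n ih =>
    rcases hy with hy | ⟨hyR, u, hu, huy⟩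
    · rcases ih hy with h | ⟨z, hz, hzR, h⟩
      · exact Or.inl h
      · exact Or.inr ⟨z, hz, hzR, ballIn_mono R z (Nat.le_succ n) h⟩
    · rcases ih hu with ⟨T, hT, hxT, huT, hd⟩ | ⟨z, hz, hzR, h⟩
      · exact hstep T hT hxT hd u huT y hyR huy _
      · exact Or.inr ⟨z, hz, hzR, mem_ballIn_succ h hyR huy⟩

/-- If every vertex of `R` can be separated from the members of `𝓑` by few vertices, then so can
every ball in `R`. -/
theorem exists_separator_of_ball {d : ℕ} {R : Set V} {𝓑 : Set (Set V)}
    (hup : ∀ C ∈ 𝓑, ∀ C', C ⊆ C' → G.ConnectedOn C' → C' ∈ 𝓑)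
    (hconn : ∀ C ∈ 𝓑, G.ConnectedOn C)
    (hsep : ∀ v ∈ R, ∃ Z : Finset V, Z.card ≤ d ∧ v ∉ Z ∧
      ∀ C ∈ 𝓑, v ∈ C → ¬ Disjoint (Z : Set V) C) (r : ℕ) :
    ∀ x ∈ R, ∃ Z : Finset V, Z.card ≤ (fun m => d + d * m)^[r] d ∧
      ∀ C ∈ 𝓑, C ⊆ R → Disjoint (Z : Set V) C → Disjoint C (G.ballIn R x r) := by
  classical
  induction r with
  | zero =>
    intro x hx
    obtain ⟨Z, hZ, -, hd⟩ := hsep x hx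
    exact ⟨Z, hZ, fun C hC _ hZC => Set.disjoint_singleton_right.2 fun h => hd C hC h hZC⟩
  | succ r ih =>
    rw [Function.iterate_succ_apply']
    set c := (fun m => d + d * m)^[r] d
    intro x hx
    obtain ⟨Z, hZ, hxZ, hd⟩ := hsep x hx
    have hW : ∀ z, ∃ W : Finset V, W.card ≤ c ∧ (z ∈ R → ∀ C ∈ 𝓑, C ⊆ R →
        Disjoint (W : Set V) C → Disjoint C (G.ballIn R z r)) := by
      intro z
      by_cases hz : z ∈ R
      · obtain ⟨W, h1, h2⟩ := ih z hz
        exact ⟨W, h1, fun _ => h2⟩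
      · exact ⟨∅, by simp, fun h => absurd h hz⟩
    choose W hWc hW using hW
    refine ⟨Z ∪ Z.biUnion W, ?_, ?_⟩
    · refine (Finset.card_union_le _ _).trans (add_le_add hZ ?_)
      exact (Finset.card_biUnion_le_card_mul _ _ c fun z _ => hWc z).trans
        (Nat.mul_le_mul_right _ hZ)
    · intro C hC hCR hZC
      rw [Finset.coe_union, Set.disjoint_union_left] at hZC
      rw [Set.disjoint_left]
      intro y hyC hy
      -- If `y` is reached while avoiding `Z`, then `C` extends to a member that contains `x` and
      -- avoids `Z`. Otherwise `y` lies in a smaller ball around some `z ∈ Z`, which `W z` separates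
      -- from `C`.
      rcases mem_ballIn_cases (Z := (Z : Set V)) hxZ hx hy with
        ⟨T, hT, hxT, hyT, hZT⟩ | ⟨z, hz, hzR, hyz⟩
      · have hCT := (hconn C hC).union hT ⟨y, hyC, hyT⟩
        exact hd _ (hup C hC _ Set.subset_union_left hCT) (Or.inr hxT)
          (Set.disjoint_union_right.2 ⟨hZC.1, hZT⟩)
      · refine Set.disjoint_left.1 (hW z hzR C hC hCR (hZC.2.mono_left ?_)) hyC hyz
        exact Finset.coe_subset.2 (Finset.subset_biUnion_of_mem W hz)

/-- In a biclique-free graph without long holes, pairwise intersecting connected sets have a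
bounded hitting set, provided they are closed under connected supersets. -/
theorem exists_bounded_hitting_set (l s : ℕ) (hl : 3 ≤ l) : ∃ k : ℕ,
    ∀ {V : Type u} [Finite V] {G : SimpleGraph V}, G.NoHole l → G.BicliqueFree s →
    ∀ 𝓑 : Set (Set V), (∀ C ∈ 𝓑, G.ConnectedOn C) → (∀ C ∈ 𝓑, ∀ C' ∈ 𝓑, (C ∩ C').Nonempty) →
    (∀ C ∈ 𝓑, ∀ C', C ⊆ C' → G.ConnectedOn C' → C' ∈ 𝓑) →
    ∃ Z : Finset V, Z.card ≤ k ∧ ∀ C ∈ 𝓑, ¬ Disjoint (Z : Set V) C := by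
  classical
  obtain ⟨M, d, hM⟩ := exists_not_pairwise_inseparable.{u} l s hl
  refine ⟨M + (fun m => d + d * m)^[l + 1] d, fun {V} _ {G} hno hG 𝓑 hconn hinter hup => ?_⟩
  by_contra! hcon
  have := Fintype.ofFinite V
  -- For two vertices of `D`, the members avoiding a given `Z` intersect, and their union joins the
  -- two vertices outside `Z`.
  set D : Finset V := Finset.univ.filter fun v => ∀ Z : Finset V, Z.card ≤ d → v ∉ Z →
    ∃ C ∈ 𝓑, v ∈ C ∧ Disjoint (Z : Set V) C with hD
  have hDc : D.card < M := by
    refine hM hno hG D fun x hx y hy _ Z hZ hxZ hyZ => ?_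
    obtain ⟨C, hC, hxC, hZC⟩ := (Finset.mem_filter.1 hx).2 Z hZ hxZ
    obtain ⟨C', hC', hyC', hZC'⟩ := (Finset.mem_filter.1 hy).2 Z hZ hyZ
    exact ⟨C ∪ C', (hconn C hC).union (hconn C' hC') (hinter C hC C' hC'), Or.inl hxC,
      Or.inr hyC', Set.disjoint_union_right.2 ⟨hZC, hZC'⟩⟩
  obtain ⟨C₁, hC₁, hDC₁⟩ := hcon D (by omega)
  obtain ⟨x, hx, hmeet⟩ := hno.exists_ball_meeting hl (R := (D : Set V)ᶜ)
    (𝓑 := {C ∈ 𝓑 | Disjoint (D : Set V) C}) ⟨C₁, hC₁, hDC₁⟩ (fun C hC => hconn C hC.1)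
    (fun C hC => Set.disjoint_right.1 hC.2) (fun C hC C' hC' => hinter C hC.1 C' hC'.1)
  have hsep := exists_separator_of_ball (G := G) (d := d) (R := (D : Set V)ᶜ) hup hconn
    (fun v hv => by
      have hv' : v ∉ D := hv
      simp only [hD, Finset.mem_filter, Finset.mem_univ, true_and] at hv'
      push Not at hv'
      exact hv') (l + 1)
  obtain ⟨Z, hZ, hZC⟩ := hsep x hx
  obtain ⟨C, hC, hd⟩ := hcon (D ∪ Z) ((Finset.card_union_le _ _).trans (by omega))
  rw [Finset.coe_union, Set.disjoint_union_left] at hd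
  exact hmeet C ⟨hC, hd.1⟩ (hZC C hC (Set.disjoint_right.1 hd.1) hd.2)

/-! ### Tree decompositions from balanced separators -/

/-- The subgraph induced by `S` has a tree decomposition with bags of size at most `k`, one of
which contains `W`. -/
def HasRootedDecomposition (G : SimpleGraph V) (k : ℕ) (S W : Finset V) : Prop :=
  ∃ (N : Type) (_ : Finite N) (T : SimpleGraph N) (bag : N → Finset V) (r : N), T.IsTree ∧
    (∀ v ∈ S, ∃ i, v ∈ bag i) ∧ (∀ i, bag i ⊆ S) ∧
    (∀ v ∈ S, ∀ w ∈ S, G.Adj v w → ∃ i, v ∈ bag i ∧ w ∈ bag i) ∧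
    (∀ v, (T.induce {i | v ∈ bag i}).Preconnected) ∧ W ⊆ bag r ∧ ∀ i, (bag i).card ≤ k

theorem HasRootedDecomposition.mono {k : ℕ} {S W W' : Finset V}
    (h : G.HasRootedDecomposition k S W) (hW : W' ⊆ W) : G.HasRootedDecomposition k S W' := by
  obtain ⟨N, hN, T, bag, r, h1, h2, h3, h4, h5, h6, h7⟩ := h
  exact ⟨N, hN, T, bag, r, h1, h2, h3, h4, h5, hW.trans h6, h7⟩

theorem hasRootedDecomposition_self {k : ℕ} {S : Finset V} (hS : S.card ≤ k) :
    G.HasRootedDecomposition k S S :=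
  ⟨Unit, inferInstance, ⊥, fun _ => S, (), IsTree.of_subsingleton, fun _ hv => ⟨(), hv⟩,
    fun _ => le_rfl, fun _ hv _ hw _ => ⟨(), hv, hw⟩, fun _ => Preconnected.of_subsingleton, le_rfl,
    fun _ => hS⟩

/-- Two trees joined by an edge form a tree. -/
theorem IsTree.sum_sup_edge {N₁ N₂ : Type*} [Finite N₁] [Finite N₂] {T₁ : SimpleGraph N₁}
    {T₂ : SimpleGraph N₂} (h₁ : T₁.IsTree) (h₂ : T₂.IsTree) (r₁ : N₁) (r₂ : N₂) :
    ((T₁ ⊕g T₂) ⊔ edge (Sum.inl r₁) (Sum.inr r₂)).IsTree := by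
  have hconn := h₁.1.sum_sup_edge h₂.1 (v := r₁) (w := r₂)
  rw [isTree_iff_connected_and_card]
  refine ⟨hconn, le_antisymm ?_ hconn.card_vert_le_card_edgeSet_add_one⟩
  have e₁ := (isTree_iff_connected_and_card.1 h₁).2
  have e₂ := (isTree_iff_connected_and_card.1 h₂).2
  have hsum : Nat.card (T₁ ⊕g T₂).edgeSet = Nat.card T₁.edgeSet + Nat.card T₂.edgeSet := by
    rw [Nat.card_congr edgeSetSumEquiv, Nat.card_sum]
  have hle : Nat.card ((T₁ ⊕g T₂) ⊔ edge (Sum.inl r₁) (Sum.inr r₂)).edgeSet ≤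
      Nat.card (T₁ ⊕g T₂).edgeSet + 1 := by
    rw [Nat.card_coe_set_eq, Nat.card_coe_set_eq, edgeSet_sup]
    refine (Set.ncard_union_le _ _).trans (Nat.add_le_add_left ?_ _)
    rw [edge, edgeSet_fromEdgeSet]
    exact (Set.ncard_le_ncard Set.sdiff_subset).trans (Set.ncard_singleton _).le
  rw [Nat.card_sum]
  omega

/-- Join the trees by an edge between the roots. A vertex occurring on both sides lies in both root
bags, so its nodes stay connected through the new edge. -/
theorem HasRootedDecomposition.glue [DecidableEq V] {k : ℕ} {S₁ S₂ W₁ W₂ : Finset V}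
    (h₁ : G.HasRootedDecomposition k S₁ W₁) (h₂ : G.HasRootedDecomposition k S₂ W₂)
    (hW₁ : S₁ ∩ S₂ ⊆ W₁) (hW₂ : S₁ ∩ S₂ ⊆ W₂)
    (hno : ∀ v ∈ S₁, ∀ w ∈ S₂, G.Adj v w → v ∈ S₂ ∨ w ∈ S₁) :
    G.HasRootedDecomposition k (S₁ ∪ S₂) W₁ := by
  obtain ⟨N₁, hN₁, T₁, bag₁, r₁, hT₁, hv₁, hS₁, he₁, hc₁, hr₁, hk₁⟩ := h₁
  obtain ⟨N₂, hN₂, T₂, bag₂, r₂, hT₂, hv₂, hS₂, he₂, hc₂, hr₂, hk₂⟩ := h₂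
  refine ⟨N₁ ⊕ N₂, inferInstance, (T₁ ⊕g T₂) ⊔ edge (Sum.inl r₁) (Sum.inr r₂),
    Sum.elim bag₁ bag₂, Sum.inl r₁, hT₁.sum_sup_edge hT₂ r₁ r₂, ?_, ?_, ?_, ?_, hr₁, ?_⟩
  · intro v hv
    rcases Finset.mem_union.1 hv with h | h
    · obtain ⟨i, hi⟩ := hv₁ v h
      exact ⟨Sum.inl i, hi⟩
    · obtain ⟨i, hi⟩ := hv₂ v h
      exact ⟨Sum.inr i, hi⟩
  · rintro (i | i)
    · exact (hS₁ i).trans Finset.subset_union_left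
    · exact (hS₂ i).trans Finset.subset_union_right
  · have key : ∀ v ∈ S₁, ∀ w ∈ S₂, G.Adj v w →
        ∃ i, v ∈ Sum.elim bag₁ bag₂ i ∧ w ∈ Sum.elim bag₁ bag₂ i := by
      intro v hv w hw hvw
      rcases hno v hv w hw hvw with h | h
      · obtain ⟨i, hi⟩ := he₂ v h w hw hvw
        exact ⟨Sum.inr i, hi⟩
      · obtain ⟨i, hi⟩ := he₁ v hv w h hvw
        exact ⟨Sum.inl i, hi⟩
    intro v hv w hw hvw
    rcases Finset.mem_union.1 hv with h | h <;> rcases Finset.mem_union.1 hw with h' | h'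
    · obtain ⟨i, hi⟩ := he₁ v h w h' hvw
      exact ⟨Sum.inl i, hi⟩
    · exact key v h w h' hvw
    · obtain ⟨i, hi⟩ := key w h' v h hvw.symm
      exact ⟨i, hi.2, hi.1⟩
    · obtain ⟨i, hi⟩ := he₂ v h w h' hvw
      exact ⟨Sum.inr i, hi⟩
  · intro v
    set T := ((T₁ ⊕g T₂) ⊔ edge (Sum.inl r₁) (Sum.inr r₂)).induce {i | v ∈ Sum.elim bag₁ bag₂ i}
      with hT
    let f₁ : T₁.induce {i | v ∈ bag₁ i} →g T :=
      ⟨fun x => ⟨Sum.inl x.1, x.2⟩, fun {x y} h => Or.inl (by simpa using h)⟩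
    let f₂ : T₂.induce {i | v ∈ bag₂ i} →g T :=
      ⟨fun x => ⟨Sum.inr x.1, x.2⟩, fun {x y} h => Or.inl (by simpa using h)⟩
    have hcross : ∀ (a : N₁) (ha : v ∈ bag₁ a) (b : N₂) (hb : v ∈ bag₂ b),
        T.Reachable ⟨Sum.inl a, ha⟩ ⟨Sum.inr b, hb⟩ := by
      intro a ha b hb
      have hv : v ∈ S₁ ∩ S₂ := Finset.mem_inter.2 ⟨hS₁ a ha, hS₂ b hb⟩
      have h1 := (hc₁ v ⟨a, ha⟩ ⟨r₁, hr₁ (hW₁ hv)⟩).map f₁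
      have h2 := (hc₂ v ⟨r₂, hr₂ (hW₂ hv)⟩ ⟨b, hb⟩).map f₂
      have h3 : T.Adj (f₁ ⟨r₁, hr₁ (hW₁ hv)⟩) (f₂ ⟨r₂, hr₂ (hW₂ hv)⟩) := by
        refine Or.inr ?_
        rw [edge_adj]
        exact ⟨Or.inl ⟨rfl, rfl⟩, by simp [f₁, f₂]⟩
      exact h1.trans (h3.reachable.trans h2)
    rintro ⟨a | a, ha⟩ ⟨b | b, hb⟩
    · exact (hc₁ v ⟨a, ha⟩ ⟨b, hb⟩).map f₁
    · exact hcross a ha b hb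
    · exact (hcross b hb a ha).symm
    · exact (hc₂ v ⟨a, ha⟩ ⟨b, hb⟩).map f₂
  · rintro (i | i)
    exacts [hk₁ i, hk₂ i]

open Classical in
/-- Decompositions of the components of `S \ Z` together with `Z` yield a decomposition of `S`. -/
theorem HasRootedDecomposition.of_components {k : ℕ} {S Z U : Finset V} (hZ : Z ⊆ S) (hU : U ⊆ S)
    (hk : (U ∪ Z).card ≤ k)
    (hK : ∀ K : Finset V, K ⊆ S \ Z → G.ConnectedOn (K : Set V) →
      G.HasRootedDecomposition k (K ∪ Z) (K ∩ U ∪ Z)) : G.HasRootedDecomposition k S (U ∪ Z) := by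
  -- Components of `S \ Z` are glued on one at a time; `P` is the union of those already treated.
  have key : ∀ n, ∀ P : Finset V, P ⊆ S \ Z →
      (∀ u ∈ P, ∀ v ∈ S \ Z, G.Adj u v → v ∈ P) → ((S \ Z) \ P).card = n →
      G.HasRootedDecomposition k (P ∪ (U ∪ Z)) (U ∪ Z) → G.HasRootedDecomposition k S (U ∪ Z) := by
    intro n
    induction n using Nat.strong_induction_on with
    | _ n ih =>
      intro P hP hcl hn hdec
      rcases ((S \ Z) \ P).eq_empty_or_nonempty with hemp | ⟨v, hv⟩
      · convert hdec using 1
        rw [Finset.sdiff_eq_empty_iff_subset] at hemp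
        refine subset_antisymm (fun x hx => ?_)
          (Finset.union_subset (hP.trans Finset.sdiff_subset) (Finset.union_subset hU hZ))
        by_cases hxZ : x ∈ Z
        · simp [hxZ]
        · exact Finset.mem_union_left _ (hemp (Finset.mem_sdiff.2 ⟨hx, hxZ⟩))
      · rw [Finset.mem_sdiff] at hv
        obtain ⟨K', hvK, hKS, hKc, hKcl⟩ := (G.connectedOn_singleton v).exists_component
          (R := ((S \ Z : Finset V) : Set V)) (Set.singleton_subset_iff.2 hv.1)
        obtain ⟨K, rfl⟩ : ∃ K : Finset V, (K : Set V) = K' :=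
          ⟨_, ((S \ Z).finite_toSet.subset hKS).coe_toFinset⟩
        rw [Finset.coe_subset] at hKS
        have hvK' : v ∈ K := hvK rfl
        have hKP : ∀ x ∈ K, x ∉ P := by
          intro x hxK hxP
          obtain ⟨u, -, w, hw, huP, hwP, huw⟩ :=
            hKc.exists_adj_exit (K := (P : Set V)) hxK hvK' hxP hv.2
          exact hwP (hcl u huP w (hKS hw) huw)
        refine ih _ ?_ (P ∪ K) (Finset.union_subset hP hKS) ?_ rfl ?_
        · rw [← hn]
          refine Finset.card_lt_card (Finset.ssubset_iff_subset_ne.2 ⟨?_, fun heq => ?_⟩)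
          · exact Finset.sdiff_subset_sdiff le_rfl Finset.subset_union_left
          · have := heq ▸ Finset.mem_sdiff.2 hv
            simp [hvK'] at this
        · intro u hu w hw huw
          rw [Finset.mem_union] at hu ⊢
          exact hu.imp (fun h => hcl u h w hw huw) fun h => hKcl u h w hw huw
        · have hglue := hdec.glue (hK K hKS hKc) (fun x hx => ?_) (fun x hx => ?_) ?_
          · convert hglue using 1
            ext x
            simp only [Finset.mem_union]
            tauto
          · simp only [Finset.mem_inter, Finset.mem_union] at hx ⊢
            have := hKP x
            tauto
          · simp only [Finset.mem_inter, Finset.mem_union] at hx ⊢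
            have := hKP x
            tauto
          · intro x hx w hw hxw
            rcases Finset.mem_union.1 hw with hwK | hwZ
            · by_cases hxZ : x ∈ Z
              · exact Or.inl (Finset.mem_union_right _ hxZ)
              · have hxS : x ∈ S := by
                  rcases Finset.mem_union.1 hx with h | h
                  · exact (Finset.mem_sdiff.1 (hP h)).1
                  · exact (Finset.union_subset hU hZ) h
                exact Or.inl (Finset.mem_union_left _
                  (hKcl w hwK x (Finset.mem_sdiff.2 ⟨hxS, hxZ⟩) hxw.symm))
            · exact Or.inr (by simp [hwZ])
  refine key _ ∅ (Finset.empty_subset _) (by simp) rfl ?_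
  rw [Finset.empty_union]
  exact hasRootedDecomposition_self hk

open Classical in
/-- If all sets of `4 * k` vertices have a balanced separator of size `k`, then there are tree
decompositions with bags of size at most `5 * k`. -/
theorem hasRootedDecomposition_of_balanced {k : ℕ} (hk : 1 ≤ k)
    (hbal : ∀ U : Finset V, U.card = 4 * k → ∃ Z : Finset V, Z.card ≤ k ∧
      ∀ C, G.ConnectedOn C → Disjoint (Z : Set V) C →
        2 * (U.filter fun u => u ∈ C).card ≤ U.card) (S W : Finset V) (hW : W ⊆ S)
    (hWc : W.card ≤ 3 * k) : G.HasRootedDecomposition (5 * k) S W := by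
  induction hn : (S \ W).card using Nat.strong_induction_on generalizing S W with
  | _ n ih =>
    rcases Nat.lt_or_ge S.card (4 * k) with hlt | hge
    · exact (hasRootedDecomposition_self (by omega)).mono hW
    -- The root bag `U ∪ Z` has at most `4 * k + k` vertices, and the root set `K ∩ U ∪ Z` of a
    -- component has at most `2 * k + k`. Enlarging `W` to `U` makes the induction measure drop.
    obtain ⟨U, hWU, hUS, hUc⟩ := Finset.exists_subsuperset_card_eq hW (by omega) hge
    obtain ⟨Z, hZ, hZC⟩ := hbal U hUc
    have hZS : (Z ∩ S).card ≤ k := (Finset.card_le_card Finset.inter_subset_left).trans hZ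
    refine (HasRootedDecomposition.of_components (Z := Z ∩ S) Finset.inter_subset_right hUS
      ((Finset.card_union_le _ _).trans (by omega)) ?_).mono
      (hWU.trans Finset.subset_union_left)
    intro K hKS hKc
    have hKU : (K ∩ U).card ≤ 2 * k := by
      have hd : Disjoint (Z : Set V) K := Set.disjoint_left.2 fun x hx hxK => by
        have := hKS hxK
        simp only [Finset.mem_sdiff, Finset.mem_inter] at this
        exact this.2 ⟨hx, this.1⟩
      have h1 : 2 * (K ∩ U).card ≤ U.card := by
        convert hZC K hKc hd using 3
        ext x
        simp [and_comm]
      omega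
    refine ih _ ?_ _ _ ?_ ((Finset.card_union_le _ _).trans (by omega)) rfl
    · have h1 : (K ∪ Z ∩ S) \ (K ∩ U ∪ Z ∩ S) ⊆ S \ U := by
        intro x hx
        have := @hKS x
        simp only [Finset.mem_sdiff, Finset.mem_union, Finset.mem_inter] at hx this ⊢
        tauto
      have h2 := Finset.card_le_card h1
      rw [Finset.card_sdiff_of_subset hUS] at h2
      rw [← hn, Finset.card_sdiff_of_subset hW]
      omega
    · exact Finset.union_subset_union Finset.inter_subset_left le_rfl

open Classical in
theorem treewidth_le_of_balanced [Finite V] {k : ℕ} (hk : 1 ≤ k)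
    (hbal : ∀ U : Finset V, U.card = 4 * k → ∃ Z : Finset V, Z.card ≤ k ∧
      ∀ C, G.ConnectedOn C → Disjoint (Z : Set V) C →
        2 * (U.filter fun u => u ∈ C).card ≤ U.card) : treewidth G ≤ 5 * k := by
  have := Fintype.ofFinite V
  obtain ⟨N, hN, T, bag, -, h1, h2, -, h4, h5, -, h7⟩ :=
    hasRootedDecomposition_of_balanced hk hbal Finset.univ ∅ (by simp) (by simp)
  rw [treewidth_le_iff]
  exact ⟨⟨N, hN, T, h1, bag, fun v => h2 v (Finset.mem_univ v),
    fun v w => h4 v (Finset.mem_univ v) w (Finset.mem_univ w), h5⟩,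
    fun i => (h7 i).trans (Nat.le_succ _)⟩

/-- Biclique-free graphs without long holes have bounded treewidth. -/
theorem exists_treewidth_le (l s : ℕ) (hl : 3 ≤ l) : ∃ c : ℕ, ∀ {V : Type u} [Finite V]
    {G : SimpleGraph V}, G.NoHole l → G.BicliqueFree s → treewidth G ≤ c := by
  classical
  obtain ⟨k, hk⟩ := exists_bounded_hitting_set.{u} l s hl
  refine ⟨5 * (k + 1), fun {V} _ {G} hno hG => treewidth_le_of_balanced (by omega) fun U _ => ?_⟩
  -- Members contain more than half of `U`, so they intersect pairwise, and a hitting set is a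
  -- balanced separator.
  set 𝓑 : Set (Set V) := {C | G.ConnectedOn C ∧ U.card < 2 * (U.filter fun u => u ∈ C).card}
  have hinter : ∀ C ∈ 𝓑, ∀ C' ∈ 𝓑, (C ∩ C').Nonempty := by
    rintro C ⟨-, hC⟩ C' ⟨-, hC'⟩
    by_contra hemp
    rw [Set.not_nonempty_iff_eq_empty] at hemp
    have hd : Disjoint (U.filter fun u => u ∈ C) (U.filter fun u => u ∈ C') :=
      Finset.disjoint_filter.2 fun u _ h h' => by
        have : u ∈ C ∩ C' := ⟨h, h'⟩
        simp [hemp] at this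
    have h1 := Finset.card_le_card (Finset.union_subset (Finset.filter_subset (fun u => u ∈ C) U)
      (Finset.filter_subset (fun u => u ∈ C') U))
    rw [Finset.card_union_of_disjoint hd] at h1
    omega
  have hup : ∀ C ∈ 𝓑, ∀ C', C ⊆ C' → G.ConnectedOn C' → C' ∈ 𝓑 := by
    rintro C ⟨-, hC⟩ C' hCC' hC'
    exact ⟨hC', hC.trans_le (Nat.mul_le_mul_left _
      (Finset.card_le_card (Finset.monotone_filter_right _ fun u _ h => hCC' h)))⟩
  obtain ⟨Z, hZ, hZC⟩ := hk hno hG 𝓑 (fun C hC => hC.1) hinter hup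
  refine ⟨Z, by omega, fun C hC hd => ?_⟩
  by_contra! hlt
  exact hZC C ⟨hC, hlt⟩ hd

/-! ### Cycles, cliques and bicliques as induced subgraphs -/

/-- A shorter cycle is not an induced subgraph of a longer one. -/
theorem not_cycleGraph_isIndContained {m n : ℕ} (hm : 3 ≤ m) (hmn : m < n) :
    ¬ cycleGraph m ⊴ cycleGraph n := by
  rintro ⟨f⟩
  obtain ⟨m, rfl⟩ := Nat.exists_eq_add_of_le' hm
  obtain ⟨n, rfl⟩ := Nat.exists_eq_add_of_le' (show 3 ≤ n by omega)
  -- Both cycles are 2-regular, so the image is closed under neighbours and, by connectedness, is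
  -- everything.
  have hclosed : ∀ v w, (cycleGraph (n + 3)).Adj (f v) w → w ∈ Set.range f := by
    intro v w hw
    have hsub : ((cycleGraph (m + 3)).neighborFinset v).map f.toEmbedding ⊆
        (cycleGraph (n + 3)).neighborFinset (f v) := by
      intro x hx
      simp only [Finset.mem_map, mem_neighborFinset] at hx ⊢
      obtain ⟨y, hy, rfl⟩ := hx
      exact f.map_adj_iff.2 hy
    have heq := Finset.eq_of_subset_of_card_le hsub (by
      rw [Finset.card_map, card_neighborFinset_eq_degree, card_neighborFinset_eq_degree,
        cycleGraph_degree_three_le, cycleGraph_degree_three_le])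
    rw [← mem_neighborFinset, ← heq, Finset.mem_map] at hw
    obtain ⟨y, -, rfl⟩ := hw
    exact ⟨y, rfl⟩
  have hreach : ∀ a b, (cycleGraph (n + 3)).Walk a b → a ∈ Set.range f → b ∈ Set.range f := by
    intro a b w
    induction w with
    | nil => exact id
    | cons h _ ih =>
      rintro ⟨v, rfl⟩
      exact ih (hclosed v _ h)
  have hsurj : Function.Surjective f := fun b => by
    obtain ⟨w⟩ := cycleGraph_preconnected (f 0) b
    exact hreach _ _ w ⟨0, rfl⟩
  have := Fintype.card_le_of_surjective f hsurj
  simp only [Fintype.card_fin] at this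
  omega

theorem IsClique.top_isIndContained {T : Finset V} {t : ℕ} (hT : G.IsClique T) (hc : T.card = t) :
    (⊤ : SimpleGraph (Fin t)) ⊴ G := by
  let e := T.equivFinOfCardEq hc
  refine ⟨⟨⟨fun i => (e.symm i).1, fun i j h => e.symm.injective (Subtype.ext h)⟩, ?_⟩⟩
  intro i j
  change G.Adj (e.symm i).1 (e.symm j).1 ↔ i ≠ j
  refine ⟨fun h hij => h.ne (by rw [hij]), fun h => hT (e.symm i).2 (e.symm j).2 fun heq => ?_⟩
  exact h (e.symm.injective (Subtype.ext heq))

theorem completeBipartiteGraph_isIndContained {S T : Finset V} {q : ℕ} (hS : S.card = q)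
    (hT : T.card = q) (hSi : G.IsIndepSet S) (hTi : G.IsIndepSet T)
    (hST : ∀ a ∈ S, ∀ b ∈ T, G.Adj a b) : completeBipartiteGraph (Fin q) (Fin q) ⊴ G := by
  let e := S.equivFinOfCardEq hS
  let e' := T.equivFinOfCardEq hT
  have hadj : ∀ i j, G.Adj (e.symm i).1 (e'.symm j).1 := fun i j =>
    hST _ (e.symm i).2 _ (e'.symm j).2
  have hSi' : ∀ i j, ¬ G.Adj (e.symm i).1 (e.symm j).1 := fun i j h =>
    hSi (e.symm i).2 (e.symm j).2 h.ne h
  have hTi' : ∀ i j, ¬ G.Adj (e'.symm i).1 (e'.symm j).1 := fun i j h =>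
    hTi (e'.symm i).2 (e'.symm j).2 h.ne h
  refine ⟨⟨⟨Sum.elim (fun i => (e.symm i).1) fun i => (e'.symm i).1, ?_⟩, ?_⟩⟩
  · rintro (i | i) (j | j) h
    · exact congrArg _ (e.symm.injective (Subtype.ext h))
    · exact absurd h (hadj i j).ne
    · exact absurd h (hadj j i).ne'
    · exact congrArg _ (e'.symm.injective (Subtype.ext h))
  · rintro (i | i) (j | j)
    · exact iff_of_false (hSi' i j) (by simp)
    · exact iff_of_true (hadj i j) (by simp)
    · exact iff_of_true (hadj j i).symm (by simp)
    · exact iff_of_false (hTi' i j) (by simp)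

/-- Excluding a clique and a balanced biclique as induced subgraphs excludes a larger biclique as
a subgraph. -/
theorem exists_bicliqueFree (t q : ℕ) : ∃ s : ℕ, ∀ {V : Type u} {G : SimpleGraph V},
    ¬ (⊤ : SimpleGraph (Fin t)) ⊴ G → ¬ completeBipartiteGraph (Fin q) (Fin q) ⊴ G →
    G.BicliqueFree s := by
  -- Ramsey's theorem is applied to each side; without a `t`-clique, both sides contain independent
  -- sets of size `q`.
  obtain ⟨s, hs⟩ := exists_isClique_or_isIndepSet.{u} t q
  refine ⟨s, fun {V} {G} hK hB S T hS hT hST => ?_⟩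
  rcases hs G S hS.ge with ⟨S', -, hc, hcl⟩ | ⟨S', hS', hSc, hSi⟩
  · exact hK (hcl.top_isIndContained hc)
  rcases hs G T hT.ge with ⟨T', -, hc, hcl⟩ | ⟨T', hT', hTc, hTi⟩
  · exact hK (hcl.top_isIndContained hc)
  exact hB (completeBipartiteGraph_isIndContained hSc hTc hSi hTi fun a ha b hb =>
    hST a (hS' ha) b (hT' hb))

end SimpleGraph

/-! ### Well-quasi-ordered classes -/

namespace FinGraph

/-- The cycle on `n` vertices. -/
def cycle (n : ℕ) : FinGraph.{u} where
  V := ULift (Fin n)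
  finite := inferInstance
  graph := (SimpleGraph.cycleGraph n).comap Equiv.ulift

/-- The cycle on `n` vertices is isomorphic to Mathlib's cycle graph. -/
def cycleIso (n : ℕ) : (cycle.{u} n).graph ≃g SimpleGraph.cycleGraph n :=
  SimpleGraph.Iso.comap Equiv.ulift _

/-- The holes of the graphs in a well-quasi-ordered hereditary class have bounded length. -/
theorem IsWQOByInducedSubgraph.exists_noHole {X : Set FinGraph.{u}} (hX : IsHereditary X)
    (hwqo : IsWQOByInducedSubgraph X) : ∃ l, 3 ≤ l ∧ ∀ G ∈ X, G.graph.NoHole l := by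
  by_contra! hcon
  -- Holes of unbounded length put arbitrarily long cycles into `X` by heredity, and a sequence of
  -- increasing ones is bad.
  have hfreq : ∀ n, ∃ m > n, 3 ≤ m ∧ cycle.{u} m ∈ X := by
    intro n
    obtain ⟨G, hG, hno⟩ := hcon (n + 3) (by omega)
    unfold SimpleGraph.NoHole at hno
    push Not at hno
    obtain ⟨m, hm, h⟩ := hno
    exact ⟨m, by omega, by omega, hX G hG _ ((cycleIso m).isIndContained.trans h)⟩
  obtain ⟨φ, hφ, h⟩ := Nat.exists_strictMono_subsequence hfreq
  obtain ⟨i, j, hij, hle⟩ := hwqo fun n => ⟨cycle (φ n), (h n).2⟩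
  exact SimpleGraph.not_cycleGraph_isIndContained (h i).1 (hφ hij)
    (((cycleIso _).isIndContained'.trans hle).trans (cycleIso _).isIndContained)

end FinGraph

theorem theorem3 (X : Set FinGraph.{u}) (hX : FinGraph.IsHereditary X) (t q : ℕ)
    (hK : ∀ G ∈ X, G.IsFree (⊤ : SimpleGraph (Fin t)))
    (hKqq : ∀ G ∈ X, G.IsFree (completeBipartiteGraph (Fin q) (Fin q)))
    (hwqo : FinGraph.IsWQOByInducedSubgraph X) :
    ∃ c : ℕ, ∀ G ∈ X, treewidth G.graph ≤ c := by
  obtain ⟨l, hl, hno⟩ := hwqo.exists_noHole hX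
  obtain ⟨s, hs⟩ := SimpleGraph.exists_bicliqueFree.{u} t q
  obtain ⟨c, hc⟩ := SimpleGraph.exists_treewidth_le.{u} l s hl
  refine ⟨c, fun G hG => ?_⟩
  have := G.finite
  exact hc (hno G hG) (hs (hK G hG) (hKqq G hG))
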